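/- Let $V$ be a finite-dimensional Euclidean space with scalar product $(\cdot,\cdot)$, and let $R\subset V$ be a finite, reduced, irreducible crystallographic root system in its real span $V_s\subseteq V$, with reflections $s_\alpha$ orthogonal for $(\cdot,\cdot)$ and coroots $\alpha^\vee=2\alpha/(\alpha,\alpha)$. (For example, $R$ is the root system of a complex reductive Lie algebra $\mathfrak g$ with $[\mathfrak g,\mathfrak g]$ simple, $V=V_s\oplus V'$ is a real form of a Cartan subalgebra $\mathfrak h$ of $\mathfrak g$ with $V'$ a real form of the center, and $(\cdot,\cdot)$ extends the Killing form on $V_s$, with $V'\perp V_s$.) Let $\mathfrak h=\mathbb C\otimes_{\mathbb R}V$ and $\widehat{\mathfrak h}=\mathfrak h\oplus\mathbb Cc\oplus\mathbb Cd$, and extend $(\cdot,\cdot)$ complex bilinearly to $\mathfrak h$ and then to $\widehat{\mathfrak h}$ by $(c,d)=1$, $(c,c)=(d,d)=(c,v)=(d,v)=0$ for $v\in\mathfrak h$. For $a\in\widehat{\mathfrak h}$ with $(a,a)\neq0$ put $s_a(x)=x-(x,a^\vee)a$, $a^\vee=2a/(a,a)$, and for $u\in\mathfrak h$ put $$t_u(v+\eta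 c+\xi d)=v+\xi u+\bigl(\eta-\tfrac{\xi}{2}(u,u)-(v,u)\bigr)c+\xi d .$$ Let $\widehat R=R+\mathbb Zc$. Fix simple roots $a_1,\dots,a_n$ of $R$, let $\theta$ be the highest root, $a_0=-\theta+c$, $\widehat F=\{a_0,\dots,a_n\}$, and let $\widehat R^+$ be the set of affine roots in $\widehat R$ that are nonnegative integral combinations of $\widehat F$. Let $Y\subset V$ be a lattice (a discrete subgroup) containing all coroots $\alpha^\vee$ with $(Y,R)\subseteq\mathbb Z$, let $W$ be the group generated by the $s_\alpha$ ($\alpha\in R$), let $\widehat W^Y=W\ltimes\{t_y: y\in Y\}\subset GL(\widehat{\mathfrak h})$, and let $\Omega=\{\omega\in\widehat W^Y:\omega(\widehat R^+)\subseteq\widehat R^+\}$. Let $k:\widehat R\to\mathbb C$ be $\widehat W^Y$-invariant. The extended trigonometric Cherednik algebra $\widehat H^Y(k)$ is the associative unital $\mathbb C$-algebra that contains the symmetric algebra $S(\widehat{\mathfrak h})$ and the group algebra $\mathbb C[\widehat W^Y]$ as subalgebras, for which multiplication is a linear isomorphism $S(\widehat{\mathfrak h})\otimes_{\mathbb C}\mathbb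 C[\widehat W^Y]\simeq\widehat H^Y(k)$, and in which $$s_a\cdot v=s_a(v)\cdot s_a-k_a\,(a,v)\quad(a\in\widehat F),\qquad \omega\cdot v=\omega(v)\cdot\omega\quad(\omega\in\Omega)$$ for all $v\in\widehat{\mathfrak h}$. \textbf{Proposition.} If $Y$ is a full lattice in $V$ (i.e. $Y$ spans $V$ over $\mathbb R$), then $$Z\bigl(\widehat H^Y(k)\bigr)=S(\widehat{\mathfrak h})^{\widehat W^Y}=\mathbb C[c,C],$$ where $C=\sum_{i=1}^m v_i^2+2cd\in S(\widehat{\mathfrak h})$ is the Casimir element, for an arbitrary orthonormal basis $v_1,\dots,v_m$ of $V$. Here $\mathbb C[c,C]$ is the subalgebra generated by $c$ and $C$, and $c$ and $C$ are algebraically independent. -/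

import Mathlib

open scoped TensorProduct InnerProductSpace

noncomputable section

namespace Cherednik

/-! ### The extended space `ĥ = h ⊕ ℂ c ⊕ ℂ d`, where `h = ℂ ⊗ V` -/

section Space

variable (V : Type*) [NormedAddCommGroup V] [InnerProductSpace ℝ V]

/-- `ĥ = h ⊕ ℂ c ⊕ ℂ d` with `h` the complexification of `V`; the triple `(v, η, ξ)` stands for
`v + η c + ξ d`. -/
abbrev HHat : Type _ := (ℂ ⊗[ℝ] V) × ℂ × ℂ

/-- The complex bilinear extension to `h` of the scalar product of `V`. -/
def formH : LinearMap.BilinForm ℂ (ℂ ⊗[ℝ] V) :=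
  LinearMap.BilinForm.baseChange ℂ (innerₗ V)

/-- The symmetric bilinear form on `ĥ` that extends the one on `h`, with `(c, d) = 1` and
`(c, c) = (d, d) = (c, v) = (d, v) = 0` for `v ∈ h`. -/
def formHat : LinearMap.BilinForm ℂ (HHat V) :=
  LinearMap.mk₂ ℂ (fun x y => formH V x.1 y.1 + x.2.1 * y.2.2 + x.2.2 * y.2.1)
    (by intro x x' y; simp; ring) (by intro r x y; simp; ring)
    (by intro x y y'; simp; ring) (by intro r x y; simp; ring)

variable {V}

/-- The inclusion of `V` in `ĥ`. -/
def ofV (v : V) : HHat V := ((1 : ℂ) ⊗ₜ[ℝ] v, 0, 0)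

variable (V) in
/-- The element `c` of `ĥ`. -/
def cHat : HHat V := (0, 1, 0)

variable (V) in
/-- The element `d` of `ĥ`. -/
def dHat : HHat V := (0, 0, 1)

theorem formH_one_tmul (v w : V) :
    formH V ((1 : ℂ) ⊗ₜ[ℝ] v) ((1 : ℂ) ⊗ₜ[ℝ] w) = ((⟪v, w⟫_ℝ : ℝ) : ℂ) := by
  simp [formH]

theorem formH_comm (x y : ℂ ⊗[ℝ] V) : formH V x y = formH V y x := by
  have h : LinearMap.IsSymm (formH V) :=
    LinearMap.BilinForm.IsSymm.baseChange ℂ ⟨fun x y => by simp [real_inner_comm]⟩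
  exact h.eq y x |>.symm

theorem formHat_apply (x y : HHat V) :
    formHat V x y = formH V x.1 y.1 + x.2.1 * y.2.2 + x.2.2 * y.2.1 := rfl

/-- The transformation
`t_u (v + η c + ξ d) = v + ξ u + (η - (ξ / 2) (u, u) - (v, u)) c + ξ d`, as a linear map. -/
def translFun (u : ℂ ⊗[ℝ] V) : HHat V →ₗ[ℂ] HHat V where
  toFun x := (x.1 + x.2.2 • u, x.2.1 - x.2.2 / 2 * formH V u u - formH V x.1 u, x.2.2)
  map_add' x y := by
    refine Prod.ext ?_ (Prod.ext ?_ ?_)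
    · simp [add_smul]; abel
    · simp; ring
    · simp
  map_smul' r x := by
    refine Prod.ext ?_ (Prod.ext ?_ ?_)
    · simp [mul_smul]
    · simp; ring
    · simp

/-- The transformation `t_u` as an element of `GL(ĥ)`. -/
def transl (u : ℂ ⊗[ℝ] V) : HHat V ≃ₗ[ℂ] HHat V :=
  LinearEquiv.ofLinearMap (translFun u) (translFun (-u))
    (by
      refine LinearMap.ext fun x => Prod.ext ?_ (Prod.ext ?_ ?_)
      · simp [translFun]
      · simp [translFun]; ring
      · simp [translFun])
    (by
      refine LinearMap.ext fun x => Prod.ext ?_ (Prod.ext ?_ ?_)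
      · simp [translFun]
      · simp [translFun]; ring
      · simp [translFun])

theorem transl_apply (u : ℂ ⊗[ℝ] V) (x : HHat V) :
    transl u x =
      (x.1 + x.2.2 • u, x.2.1 - x.2.2 / 2 * formH V u u - formH V x.1 u, x.2.2) := rfl

/-- The orthogonal reflection `s_a (x) = x - (x, a^∨) a`, `a^∨ = 2 a / (a, a)`, in a
non-isotropic vector `a ∈ ĥ`, as an element of `GL(ĥ)`. -/
def refl (a : HHat V) (ha : formHat V a a ≠ 0) : HHat V ≃ₗ[ℂ] HHat V :=
  Module.reflection (x := a) (f := (formHat V).flip ((2 / formHat V a a) • a))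
    (by simp [ha])

theorem refl_apply (a : HHat V) (ha : formHat V a a ≠ 0) (x : HHat V) :
    refl a ha x = x - formHat V x ((2 / formHat V a a) • a) • a := by
  simp [refl, Module.reflection_apply]

end Space

/-! ### Root systems, lattices and extended affine Weyl groups -/

/-- The root data: a finite, reduced, irreducible crystallographic root system `R`, indexed by
`ι`, spanning a subspace `V_s` of the Euclidean space `V` (so that `V = V_s ⊕ V'` with
`V' = V_s^⊥`), whose coroots are `α^∨ = 2 α / (α, α)`; a base of `R` and the highest root `θ`
with respect to it; and a lattice `Y` in `V`, not necessarily of full rank, that contains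
the coroots and has `(Y, R) ⊆ ℤ`. -/
structure AffineRootDatum (ι V : Type*) [NormedAddCommGroup V] [InnerProductSpace ℝ V] where
  Vs : Submodule ℝ V
  P : RootPairing ι ℝ Vs (Module.Dual ℝ Vs)
  isRootSystem : P.IsRootSystem
  isReduced : P.IsReduced
  isCrystallographic : P.IsCrystallographic
  isIrreducible : P.IsIrreducible
  /-- The pairing with the coroot of `α` is the scalar product with `2 α / (α, α)`. -/
  pairing_coroot (i : ι) (x : Vs) :
    P.toLinearMap x (P.coroot i) =
      2 * ⟪(x : V), (P.root i : V)⟫_ℝ / ⟪(P.root i : V), (P.root i : V)⟫_ℝ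
  base : P.Base
  θ : ι
  /-- `θ` is the highest root: `θ - α` is a sum of simple roots, for every root `α`. -/
  highest (i : ι) : P.root θ - P.root i ∈ AddSubmonoid.closure (P.root '' base.support)
  Y : Submodule ℤ V
  discrete : DiscreteTopology Y
  coroot_mem (i : ι) :
    (2 / ⟪(P.root i : V), (P.root i : V)⟫_ℝ) • (P.root i : V) ∈ Y
  inner_root_int (y : V) (hy : y ∈ Y) (i : ι) : ∃ n : ℤ, ⟪y, (P.root i : V)⟫_ℝ = n

namespace AffineRootDatum

variable {ι V : Type*} [NormedAddCommGroup V] [InnerProductSpace ℝ V] (D : AffineRootDatum ι V)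

/-- The roots, as vectors of `V`. -/
def root (i : ι) : V := (D.P.root i : V)

theorem inner_root_ne_zero (i : ι) : ⟪D.root i, D.root i⟫_ℝ ≠ 0 := by
  intro h
  have h2 := D.P.root_coroot_two i
  rw [D.pairing_coroot] at h2
  change 2 * ⟪D.root i, D.root i⟫_ℝ / ⟪D.root i, D.root i⟫_ℝ = 2 at h2
  rw [h] at h2
  norm_num at h2

/-- The affine root system `R̂ = R + ℤ c`. -/
def affRoots : Set (HHat V) :=
  {a | ∃ (i : ι) (m : ℤ), a = ofV (D.root i) + (m : ℂ) • cHat V}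

/-- The set `F̂` of simple affine roots: `a_0 = -θ + c` and the simple roots of `R`. -/
def simpleAffRoots : Set (HHat V) :=
  insert (-ofV (D.root D.θ) + cHat V) ((fun i => ofV (D.root i)) '' D.base.support)

/-- The positive affine roots `R̂⁺`: the affine roots that are sums of simple ones. -/
def posAffRoots : Set (HHat V) :=
  {a | a ∈ D.affRoots ∧ a ∈ AddSubmonoid.closure D.simpleAffRoots}

theorem formHat_affRoot (i : ι) (m : ℤ) :
    formHat V (ofV (D.root i) + (m : ℂ) • cHat V) (ofV (D.root i) + (m : ℂ) • cHat V) =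
      ((⟪D.root i, D.root i⟫_ℝ : ℝ) : ℂ) := by
  rw [formHat_apply]
  simp [ofV, cHat, formH_one_tmul]

theorem formHat_self_ne_zero (a : D.affRoots) : formHat V (a : HHat V) a ≠ 0 := by
  obtain ⟨a, i, m, rfl⟩ := a
  rw [formHat_affRoot]
  exact_mod_cast D.inner_root_ne_zero i

/-- The affine reflection `s_a ∈ GL(ĥ)`, for `a ∈ R̂`. -/
def affRefl (a : D.affRoots) : HHat V ≃ₗ[ℂ] HHat V :=
  refl (a : HHat V) (D.formHat_self_ne_zero a)

theorem ofV_root_mem (i : ι) : ofV (D.root i) ∈ D.affRoots := ⟨i, 0, by simp⟩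

/-- The finite Weyl group `W`, generated by the `s_α`, `α ∈ R`, as a subgroup of `GL(ĥ)`. -/
def weyl : Subgroup (HHat V ≃ₗ[ℂ] HHat V) :=
  Subgroup.closure (Set.range fun i : ι => D.affRefl ⟨ofV (D.root i), D.ofV_root_mem i⟩)

/-- The group of the `t_y`, `y ∈ Y`, as a subgroup of `GL(ĥ)`. -/
def translations : Subgroup (HHat V ≃ₗ[ℂ] HHat V) :=
  Subgroup.closure ((fun y : V => transl ((1 : ℂ) ⊗ₜ[ℝ] y)) '' D.Y)

/-- The extended affine Weyl group `Ŵ^Y = W ⋉ Y`, as a subgroup of `GL(ĥ)`: since `W` normalizes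
the translations `t_y` and meets them trivially, it is generated by the two subgroups. -/
def extAffWeyl : Subgroup (HHat V ≃ₗ[ℂ] HHat V) := D.weyl ⊔ D.translations

/-- `s_{α + m c} = s_α t_{m α^∨}`. -/
theorem affRefl_eq (i : ι) (m : ℤ) (h : ofV (D.root i) + (m : ℂ) • cHat V ∈ D.affRoots) :
    D.affRefl ⟨ofV (D.root i) + (m : ℂ) • cHat V, h⟩ =
      D.affRefl ⟨ofV (D.root i), D.ofV_root_mem i⟩ *
        transl ((1 : ℂ) ⊗ₜ[ℝ]
          (m • ((2 / ⟪D.root i, D.root i⟫_ℝ) • D.root i))) := by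
  have h0 : ((⟪D.root i, D.root i⟫_ℝ : ℝ) : ℂ) ≠ 0 := by
    exact_mod_cast D.inner_root_ne_zero i
  have e0 : formHat V (ofV (D.root i)) (ofV (D.root i)) =
      ((⟪D.root i, D.root i⟫_ℝ : ℝ) : ℂ) := by
    simpa using D.formHat_affRoot i 0
  have hu : (1 : ℂ) ⊗ₜ[ℝ] (m • ((2 / ⟪D.root i, D.root i⟫_ℝ) • D.root i)) =
      ((m : ℂ) * (2 / ((⟪D.root i, D.root i⟫_ℝ : ℝ) : ℂ))) • ((1 : ℂ) ⊗ₜ[ℝ] D.root i) := by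
    rw [← Int.cast_smul_eq_zsmul ℝ m, smul_smul, ← TensorProduct.smul_tmul,
      TensorProduct.smul_tmul']
    congr 1
    simp
  ext x : 1
  rw [LinearEquiv.mul_apply, affRefl, affRefl, refl_apply, refl_apply, hu]
  simp only [e0, formHat_affRoot]
  generalize hq : ((⟪D.root i, D.root i⟫_ℝ : ℝ) : ℂ) = q at *
  have hf : formH V ((1 : ℂ) ⊗ₜ[ℝ] D.root i) ((1 : ℂ) ⊗ₜ[ℝ] D.root i) = q := by
    rw [formH_one_tmul, hq]
  refine Prod.ext ?_ (Prod.ext ?_ ?_)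
  · simp only [transl_apply, formHat_apply, ofV, cHat]
    simp [hf]
    match_scalars <;> field_simp
    ring
  · simp only [transl_apply, formHat_apply, ofV, cHat]
    simp [hf]
    field_simp
    ring
  · simp only [transl_apply, formHat_apply, ofV, cHat]
    simp

/-- The reflections `s_a`, `a ∈ R̂`, belong to `Ŵ^Y`. -/
theorem affRefl_mem (a : D.affRoots) : D.affRefl a ∈ D.extAffWeyl := by
  obtain ⟨a, i, m, rfl⟩ := a
  refine (D.affRefl_eq i m ⟨i, m, rfl⟩) ▸ mul_mem ?_ ?_
  · exact Subgroup.mem_sup_left (Subgroup.subset_closure ⟨i, rfl⟩)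
  · exact Subgroup.mem_sup_right (Subgroup.subset_closure
      ⟨_, D.Y.smul_mem m (D.coroot_mem i), rfl⟩)

/-- The reflection `s_a`, `a ∈ R̂`, as an element of `Ŵ^Y`. -/
def s (a : D.affRoots) : D.extAffWeyl := ⟨D.affRefl a, D.affRefl_mem a⟩

/-- The subset `Ω` of the `ω ∈ Ŵ^Y` with `ω(R̂⁺) ⊆ R̂⁺`. -/
def Omega : Set D.extAffWeyl :=
  {ω | ∀ a ∈ D.posAffRoots, (ω : HHat V ≃ₗ[ℂ] HHat V) a ∈ D.posAffRoots}

/-- A multiplicity function: a `Ŵ^Y`-invariant function `k : R̂ → ℂ`. -/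
def IsMultiplicity (k : D.affRoots → ℂ) : Prop :=
  ∀ w ∈ D.extAffWeyl, ∀ a b : D.affRoots, w (a : HHat V) = b → k b = k a

/-- The action of `GL(ĥ)` on the symmetric algebra `S(ĥ)` by algebra homomorphisms. -/
def symAct (w : HHat V ≃ₗ[ℂ] HHat V) :
    SymmetricAlgebra ℂ (HHat V) →ₐ[ℂ] SymmetricAlgebra ℂ (HHat V) :=
  SymmetricAlgebra.lift (SymmetricAlgebra.ι ℂ (HHat V) ∘ₗ w.toLinearMap)

/-- The invariant subalgebra `S(ĥ)^{Ŵ^Y}`. -/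
def invariants : Subalgebra ℂ (SymmetricAlgebra ℂ (HHat V)) where
  carrier := {p | ∀ w ∈ D.extAffWeyl, symAct w p = p}
  mul_mem' hp hq w hw := by rw [map_mul, hp w hw, hq w hw]
  add_mem' hp hq w hw := by rw [map_add, hp w hw, hq w hw]
  algebraMap_mem' r w _ := by rw [AlgHom.commutes]

/-- The structure of extended trigonometric Cherednik algebra `Ĥ^Y(k)` on a `ℂ`-algebra `H`.
`H` contains `S(ĥ)` and the group algebra `ℂ[Ŵ^Y]` as subalgebras, multiplication
`S(ĥ) ⊗ ℂ[Ŵ^Y] → H` is a linear isomorphism, and the cross relations hold. These conditions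
determine `H`, with its two subalgebras, up to a unique isomorphism. -/
structure ExtTrigCherednik (k : D.affRoots → ℂ) (H : Type*) [Ring H] [Algebra ℂ H] where
  /-- the inclusion of `S(ĥ)` -/
  ofSym : SymmetricAlgebra ℂ (HHat V) →ₐ[ℂ] H
  /-- the inclusion of `ℂ[Ŵ^Y]` -/
  ofGrp : MonoidAlgebra ℂ D.extAffWeyl →ₐ[ℂ] H
  ofSym_injective : Function.Injective ofSym
  ofGrp_injective : Function.Injective ofGrp
  mul_bijective : Function.Bijective
    (LinearMap.mul' ℂ H ∘ₗ TensorProduct.map ofSym.toLinearMap ofGrp.toLinearMap)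
  /-- `s_a · v = s_a(v) · s_a - k_a (a, v)` for `a ∈ F̂` and `v ∈ ĥ`. -/
  cross_refl (a : D.affRoots) (ha : (a : HHat V) ∈ D.simpleAffRoots) (v : HHat V) :
    ofGrp (MonoidAlgebra.of ℂ _ (D.s a)) * ofSym (SymmetricAlgebra.ι ℂ _ v) =
      ofSym (SymmetricAlgebra.ι ℂ _ (D.affRefl a v)) * ofGrp (MonoidAlgebra.of ℂ _ (D.s a)) -
        algebraMap ℂ H (k a * formHat V a v)
  /-- `ω · v = ω(v) · ω` for `ω ∈ Ω` and `v ∈ ĥ`. -/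
  cross_omega (ω : D.extAffWeyl) (hω : ω ∈ D.Omega) (v : HHat V) :
    ofGrp (MonoidAlgebra.of ℂ _ ω) * ofSym (SymmetricAlgebra.ι ℂ _ v) =
      ofSym (SymmetricAlgebra.ι ℂ _ ((ω : HHat V ≃ₗ[ℂ] HHat V) v)) *
        ofGrp (MonoidAlgebra.of ℂ _ ω)

end AffineRootDatum

/-- The element `c`, in the symmetric algebra `S(ĥ)`. -/
def symC (V : Type*) [NormedAddCommGroup V] [InnerProductSpace ℝ V] :
    SymmetricAlgebra ℂ (HHat V) :=
  SymmetricAlgebra.ι ℂ (HHat V) (cHat V)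

/-- The Casimir element `C = ∑ v_i² + 2 c d ∈ S(ĥ)` of an orthonormal basis `(v_i)` of `V`. -/
def casimir {V : Type*} [NormedAddCommGroup V] [InnerProductSpace ℝ V] {m : ℕ}
    (v : OrthonormalBasis (Fin m) ℝ V) : SymmetricAlgebra ℂ (HHat V) :=
  ∑ i, SymmetricAlgebra.ι ℂ (HHat V) (ofV (v i)) ^ 2 +
    2 * SymmetricAlgebra.ι ℂ (HHat V) (cHat V) * SymmetricAlgebra.ι ℂ (HHat V) (dHat V)

end Cherednik

end

/-! Two computations meet: the invariants are ℂ[c, C], and the center is the algebra of invariants.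

For the first, an element of S(ĥ) is treated as a polynomial function of functionals l on ĥ.
Invariance under the translations of a full lattice is a polynomial condition satisfied on a
Zariski-dense set, so it extends to all t_u with u ∈ h (`transl_mem_stab`). When l(c) ≠ 0, some t_u
carries l to a functional that vanishes on h, and such a functional is determined by the values l(c)
and l(C). Hence an invariant p satisfies c^N p ∈ ℂ[c, C] for some N (`exists_mem_adjoin`,
`mem_adjoin_of_forall_transl_mem_stab`). Powers of c cancel because C still takes all values on the
locus l(c) = 0 (`mem_adjoin_of_symC_mul_mem`). Conversely, finite reflections and translations are
isometries fixing c, so they fix C.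

For the second, Ĥ^Y(k) is filtered by length in Ŵ^Y, and w v = w(v) w modulo shorter elements
(`T_mul_ofSym_ι_sub_mem_lower`). Commuting z with v ∈ ĥ multiplies a coefficient at w of maximal
length by w(v) - v. As S(ĥ) is a domain and Ŵ^Y acts faithfully, a central z has only w = 1 in its
support. An element p ∈ S(ĥ) commutes with Ω and the simple s_a exactly when they fix it, because
the error term in s_a p is a multiple of the divided difference (p - s_a(p)) / a
(`exists_T_s_mul_ofSym`). That Ω and the simple s_a generate Ŵ^Y (`exists_isWord`) follows by
decreasing the number of positive affine roots made negative. -/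

namespace Cherednik

/-! ### Points of the symmetric algebra -/

section Points

variable {V : Type*} [NormedAddCommGroup V] [InnerProductSpace ℝ V]

/-- An element of `S(ĥ)` is determined by its values at all linear functionals on `ĥ`. -/
theorem eq_of_forall_lift_eq [FiniteDimensional ℝ V] {p q : SymmetricAlgebra ℂ (HHat V)}
    (h : ∀ l : HHat V →ₗ[ℂ] ℂ, SymmetricAlgebra.lift l p = SymmetricAlgebra.lift l q) :
    p = q := by
  -- In coordinates functionals are points of affine space, and a polynomial over an infinite field
  -- is determined by its values.
  let b := Module.finBasis ℂ (HHat V)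
  apply (SymmetricAlgebra.equivMvPolynomial b).injective
  refine MvPolynomial.funext fun x => ?_
  have key : (MvPolynomial.aeval x).comp (SymmetricAlgebra.equivMvPolynomial b).toAlgHom =
      SymmetricAlgebra.lift (b.constr ℂ x) := by
    refine SymmetricAlgebra.algHom_ext (b.ext fun i => ?_)
    simp
  have h1 : ∀ p, MvPolynomial.eval x (SymmetricAlgebra.equivMvPolynomial b p) =
      SymmetricAlgebra.lift (b.constr ℂ x) p := fun p => DFunLike.congr_fun key p
  rw [h1, h1, h]

theorem ι_injective [FiniteDimensional ℝ V] :
    Function.Injective (SymmetricAlgebra.ι ℂ (HHat V)) := by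
  intro x y h
  refine (Module.forall_dual_apply_eq_zero_iff ℂ (x - y)).mp (fun l => ?_) |> sub_eq_zero.mp
  have := congrArg (SymmetricAlgebra.lift l) h
  simpa [sub_eq_zero] using this

theorem symAct_ι (w : HHat V ≃ₗ[ℂ] HHat V) (x : HHat V) :
    AffineRootDatum.symAct w (SymmetricAlgebra.ι ℂ _ x) = SymmetricAlgebra.ι ℂ _ (w x) := by
  simp [AffineRootDatum.symAct]

theorem symAct_mul (w w' : HHat V ≃ₗ[ℂ] HHat V) (p : SymmetricAlgebra ℂ (HHat V)) :
    AffineRootDatum.symAct (w * w') p =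
      AffineRootDatum.symAct w (AffineRootDatum.symAct w' p) := by
  have : AffineRootDatum.symAct (w * w') =
      (AffineRootDatum.symAct w).comp (AffineRootDatum.symAct w') := by
    refine SymmetricAlgebra.algHom_ext (LinearMap.ext fun x => ?_)
    simp [symAct_ι]
  rw [this, AlgHom.comp_apply]

theorem symAct_one (p : SymmetricAlgebra ℂ (HHat V)) :
    AffineRootDatum.symAct (1 : HHat V ≃ₗ[ℂ] HHat V) p = p := by
  have : AffineRootDatum.symAct (1 : HHat V ≃ₗ[ℂ] HHat V) = AlgHom.id ℂ _ := by
    refine SymmetricAlgebra.algHom_ext (LinearMap.ext fun x => ?_)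
    simp [symAct_ι]
  rw [this, AlgHom.id_apply]

theorem lift_symAct (l : HHat V →ₗ[ℂ] ℂ) (w : HHat V ≃ₗ[ℂ] HHat V)
    (p : SymmetricAlgebra ℂ (HHat V)) :
    SymmetricAlgebra.lift l (AffineRootDatum.symAct w p) =
      SymmetricAlgebra.lift (l ∘ₗ w.toLinearMap) p := by
  have : (SymmetricAlgebra.lift l).comp (AffineRootDatum.symAct w) =
      SymmetricAlgebra.lift (l ∘ₗ w.toLinearMap) := by
    refine SymmetricAlgebra.algHom_ext (LinearMap.ext fun x => ?_)
    simp [symAct_ι]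
  rw [← this, AlgHom.comp_apply]

/-- The stabilizer in `GL(ĥ)` of an element of `S(ĥ)`. -/
def stab (p : SymmetricAlgebra ℂ (HHat V)) : Subgroup (HHat V ≃ₗ[ℂ] HHat V) where
  carrier := {w | AffineRootDatum.symAct w p = p}
  mul_mem' {a b} ha hb := by
    simp only [Set.mem_ofPred_eq] at *
    rw [symAct_mul, hb, ha]
  one_mem' := symAct_one p
  inv_mem' {a} ha := by
    simp only [Set.mem_ofPred_eq] at *
    conv_lhs => rw [← ha]
    rw [← symAct_mul, inv_mul_cancel, symAct_one]

theorem mem_stab {p : SymmetricAlgebra ℂ (HHat V)} {w : HHat V ≃ₗ[ℂ] HHat V} :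
    w ∈ stab p ↔ AffineRootDatum.symAct w p = p := Iff.rfl

theorem transl_add (u u' : ℂ ⊗[ℝ] V) : transl (u + u') = transl u * transl u' := by
  ext x : 1
  rw [LinearEquiv.mul_apply, transl_apply, transl_apply, transl_apply]
  have hc := formH_comm u u'
  refine Prod.ext ?_ (Prod.ext ?_ ?_)
  · simp only [smul_add]; abel
  · simp only [map_add, LinearMap.add_apply, map_smul, LinearMap.smul_apply, smul_eq_mul, hc]
    ring
  · rfl

theorem eq_add_smul_cHat_add_smul_dHat (x : HHat V) : x = (x.1, 0, 0) + x.2.1 • cHat V + x.2.2 • dHat V := by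
  refine Prod.ext ?_ (Prod.ext ?_ ?_) <;> simp [cHat, dHat]

/-- An element of `S(ĥ)` fixed by all `t_{n u}`, `n ∈ ℤ`, is fixed by all `t_{r u}`, `r ∈ ℂ`. -/
theorem transl_smul_mem_stab [FiniteDimensional ℝ V] {p : SymmetricAlgebra ℂ (HHat V)}
    {u : ℂ ⊗[ℝ] V} (h : ∀ n : ℕ, transl ((n : ℂ) • u) ∈ stab p) (r : ℂ) :
    transl (r • u) ∈ stab p := by
  refine eq_of_forall_lift_eq fun l => ?_
  -- For fixed l, the value at t_{ru}(p) is polynomial in r: it is quadratic in r when p ∈ ĥ, and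
  -- this passes to sums and products. A polynomial constant on ℕ is constant.
  have hP : ∀ p : SymmetricAlgebra ℂ (HHat V), ∃ P : Polynomial ℂ, ∀ r : ℂ,
      P.eval r = SymmetricAlgebra.lift l (AffineRootDatum.symAct (transl (r • u)) p) := by
    intro p
    induction p using SymmetricAlgebra.induction with
    | algebraMap a => exact ⟨Polynomial.C a, fun r => by simp [AlgHom.commutes]⟩
    | ι x =>
      refine ⟨Polynomial.C (l x) +
        Polynomial.X * Polynomial.C (x.2.2 * l (u, 0, 0) - formH V x.1 u * l (cHat V)) -
        Polynomial.X ^ 2 * Polynomial.C (x.2.2 / 2 * formH V u u * l (cHat V)), fun r => ?_⟩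
      have hx : transl (r • u) x = x + (r * x.2.2) • (u, 0, 0) -
          (x.2.2 / 2 * (r ^ 2 * formH V u u) + r * formH V x.1 u) • cHat V := by
        rw [transl_apply]
        refine Prod.ext ?_ (Prod.ext ?_ ?_)
        · simp [cHat, smul_smul, mul_comm]
        · simp [cHat]; ring
        · simp [cHat]
      rw [symAct_ι, SymmetricAlgebra.lift_ι_apply, hx, map_sub l, map_add l, map_smul l,
        map_smul l]
      simp only [Polynomial.eval_add, Polynomial.eval_sub, Polynomial.eval_mul,
        Polynomial.eval_pow, Polynomial.eval_C, Polynomial.eval_X, smul_eq_mul]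
      ring
    | mul a b ha hb =>
      obtain ⟨P, hP⟩ := ha
      obtain ⟨Q, hQ⟩ := hb
      exact ⟨P * Q, fun r => by simp [hP, hQ]⟩
    | add a b ha hb =>
      obtain ⟨P, hP⟩ := ha
      obtain ⟨Q, hQ⟩ := hb
      exact ⟨P + Q, fun r => by simp [hP, hQ]⟩
  obtain ⟨P, hP⟩ := hP p
  have hP0 : P - Polynomial.C (SymmetricAlgebra.lift l p) = 0 := by
    refine Polynomial.eq_zero_of_infinite_isRoot _ ?_
    refine (Set.infinite_range_of_injective (Nat.cast_injective (R := ℂ))).mono ?_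
    rintro _ ⟨n, rfl⟩
    simp [hP, mem_stab.mp (h n)]
  rw [← hP, sub_eq_zero.mp hP0, Polynomial.eval_C]

/-- An element of `S(ĥ)` fixed by the translations of a full lattice is fixed by all
translations. -/
theorem transl_mem_stab [FiniteDimensional ℝ V] {Y : Submodule ℤ V}
    (hY : Submodule.span ℝ (Y : Set V) = ⊤) {p : SymmetricAlgebra ℂ (HHat V)}
    (h : ∀ y ∈ Y, transl ((1 : ℂ) ⊗ₜ[ℝ] y) ∈ stab p) (u : ℂ ⊗[ℝ] V) : transl u ∈ stab p := by
  have h1 : ∀ y : V, ∀ r : ℂ, transl (r ⊗ₜ[ℝ] y) ∈ stab p := by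
    intro y
    have hy : y ∈ Submodule.span ℝ (Y : Set V) := hY ▸ Submodule.mem_top
    induction hy using Submodule.span_induction with
    | mem y hy =>
      intro r
      have := transl_smul_mem_stab (p := p) (u := (1 : ℂ) ⊗ₜ[ℝ] y) (fun n => by
        have := h _ (Y.smul_mem (n : ℤ) hy)
        rwa [← Int.cast_smul_eq_zsmul ℝ, ← TensorProduct.smul_tmul,
          show ((n : ℤ) : ℝ) • (1 : ℂ) = (n : ℂ) • (1 : ℂ) by simp,
          ← TensorProduct.smul_tmul'] at this) r
      rwa [TensorProduct.smul_tmul', smul_eq_mul, mul_one] at this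
    | zero => exact fun r => by simpa using h 0 Y.zero_mem
    | add x y _ _ hx hy =>
      intro r
      rw [TensorProduct.tmul_add, transl_add]
      exact mul_mem (hx r) (hy r)
    | smul a x _ hx =>
      intro r
      rw [← TensorProduct.smul_tmul]
      exact hx _
  induction u using TensorProduct.induction_on with
  | zero => simpa using h 0 Y.zero_mem
  | tmul r y => exact h1 y r
  | add x y hx hy => rw [transl_add]; exact mul_mem hx hy

end Points

/-! ### The Casimir element -/

section Casimir

variable {V : Type*} [NormedAddCommGroup V] [InnerProductSpace ℝ V] {m : ℕ}
  (v : OrthonormalBasis (Fin m) ℝ V)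

-- A real orthonormal basis of V is also orthonormal for the bilinear (not Hermitian) extension of
-- the form to h; this is its expansion formula.
include v in
theorem sum_formH_smul (u : ℂ ⊗[ℝ] V) :
    ∑ i, formH V ((1 : ℂ) ⊗ₜ[ℝ] v i) u • ((1 : ℂ) ⊗ₜ[ℝ] v i) = u := by
  induction u using TensorProduct.induction_on with
  | zero => simp
  | add x y hx hy => simp only [map_add, add_smul, Finset.sum_add_distrib, hx, hy]
  | tmul r y =>
    conv_rhs => rw [← v.sum_repr' y, TensorProduct.tmul_sum]
    refine Finset.sum_congr rfl fun i _ => ?_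
    have h : r ⊗ₜ[ℝ] y = r • ((1 : ℂ) ⊗ₜ[ℝ] y) := by
      rw [TensorProduct.smul_tmul', smul_eq_mul, mul_one]
    rw [h, map_smul, formH_one_tmul, TensorProduct.smul_tmul', ← TensorProduct.smul_tmul]
    congr 1
    simp [mul_comm]

include v in
theorem sum_formH_mul_formH (u u' : ℂ ⊗[ℝ] V) :
    ∑ i, formH V ((1 : ℂ) ⊗ₜ[ℝ] v i) u * formH V ((1 : ℂ) ⊗ₜ[ℝ] v i) u' = formH V u u' := by
  conv_rhs => rw [← sum_formH_smul v u, map_sum, LinearMap.sum_apply]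
  simp

theorem lift_casimir (l : HHat V →ₗ[ℂ] ℂ) :
    SymmetricAlgebra.lift l (casimir v) =
      ∑ i, l (ofV (v i)) ^ 2 + 2 * l (cHat V) * l (dHat V) := by
  have h2 : SymmetricAlgebra.lift l (2 : SymmetricAlgebra ℂ (HHat V)) = 2 := map_ofNat _ 2
  simp [casimir, h2]

theorem lift_symC (l : HHat V →ₗ[ℂ] ℂ) : SymmetricAlgebra.lift l (symC V) = l (cHat V) := by
  simp [symC]

include v in
theorem sum_formH_mul_apply (l : HHat V →ₗ[ℂ] ℂ) (u : ℂ ⊗[ℝ] V) :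
    ∑ i, formH V ((1 : ℂ) ⊗ₜ[ℝ] v i) u * l (ofV (v i)) = l (u, 0, 0) := by
  have h := congrArg (l ∘ₗ LinearMap.inl ℂ (ℂ ⊗[ℝ] V) (ℂ × ℂ)) (sum_formH_smul v u)
  rw [map_sum] at h
  simp only [map_smul, smul_eq_mul] at h
  exact h

theorem transl_mem_stab_symC [FiniteDimensional ℝ V] (u : ℂ ⊗[ℝ] V) :
    transl u ∈ stab (symC V) := by
  rw [mem_stab, symC, symAct_ι, transl_apply]
  simp [cHat]

theorem transl_ofV (u : ℂ ⊗[ℝ] V) (x : V) :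
    transl u (ofV x) = ofV x - formH V ((1 : ℂ) ⊗ₜ[ℝ] x) u • cHat V := by
  rw [transl_apply]
  refine Prod.ext ?_ (Prod.ext ?_ ?_) <;> simp [ofV, cHat]

theorem transl_cHat (u : ℂ ⊗[ℝ] V) : transl u (cHat V) = cHat V := by
  rw [transl_apply]
  refine Prod.ext ?_ (Prod.ext ?_ ?_) <;> simp [cHat]

theorem transl_dHat (u : ℂ ⊗[ℝ] V) :
    transl u (dHat V) = dHat V + (u, 0, 0) - (formH V u u / 2) • cHat V := by
  rw [transl_apply]
  refine Prod.ext ?_ (Prod.ext ?_ ?_)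
  · simp [cHat, dHat]
  · simp [cHat, dHat]; ring
  · simp [cHat, dHat]

theorem transl_mem_stab_casimir [FiniteDimensional ℝ V] (u : ℂ ⊗[ℝ] V) :
    transl u ∈ stab (casimir v) := by
  refine eq_of_forall_lift_eq fun l => ?_
  rw [lift_symAct, lift_casimir, lift_casimir]
  simp only [LinearMap.comp_apply, LinearEquiv.coe_coe, transl_ofV, transl_cHat, transl_dHat,
    map_sub, map_smul, map_add, smul_eq_mul]
  have h1 := sum_formH_mul_apply v l u
  have h2 := sum_formH_mul_formH v u u
  -- Expanding the squares leaves a term linear in u and one quadratic in u. They cancel against the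
  -- contribution of t_u(d) to 2cd.
  have h3 : ∑ i, (l (ofV (v i)) - formH V ((1 : ℂ) ⊗ₜ[ℝ] v i) u * l (cHat V)) ^ 2 =
      ∑ i, l (ofV (v i)) ^ 2 -
        2 * l (cHat V) * ∑ i, formH V ((1 : ℂ) ⊗ₜ[ℝ] v i) u * l (ofV (v i)) +
        l (cHat V) ^ 2 *
          ∑ i, formH V ((1 : ℂ) ⊗ₜ[ℝ] v i) u * formH V ((1 : ℂ) ⊗ₜ[ℝ] v i) u := by
    rw [Finset.mul_sum, Finset.mul_sum, ← Finset.sum_sub_distrib, ← Finset.sum_add_distrib]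
    exact Finset.sum_congr rfl fun i _ => by ring
  rw [h3, h1, h2]
  ring

theorem refl_mem_stab_symC (x : V) (hx : formHat V (ofV x) (ofV x) ≠ 0) :
    refl (ofV x) hx ∈ stab (symC V) := by
  rw [mem_stab, symC, symAct_ι, refl_apply]
  simp [formHat_apply, ofV, cHat]

theorem refl_mem_stab_casimir [FiniteDimensional ℝ V] (x : V)
    (hx : formHat V (ofV x) (ofV x) ≠ 0) : refl (ofV x) hx ∈ stab (casimir v) := by
  refine eq_of_forall_lift_eq fun l => ?_
  rw [lift_symAct, lift_casimir, lift_casimir]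
  set u : ℂ ⊗[ℝ] V := (1 : ℂ) ⊗ₜ[ℝ] x with hu
  have hq : formHat V (ofV x) (ofV x) = formH V u u := by simp [formHat_apply, ofV, hu]
  have hq0 : formH V u u ≠ 0 := hq ▸ hx
  have hc : refl (ofV x) hx (cHat V) = cHat V := by
    simp [refl_apply, formHat_apply, ofV, cHat]
  have hd : refl (ofV x) hx (dHat V) = dHat V := by
    simp [refl_apply, formHat_apply, ofV, dHat]
  have hv (i : Fin m) : refl (ofV x) hx (ofV (v i)) =
      ofV (v i) - (2 / formH V u u * formH V ((1 : ℂ) ⊗ₜ[ℝ] v i) u) • ofV x := by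
    rw [refl_apply, hq, map_smul, smul_eq_mul]
    congr 3
    simp [formHat_apply, ofV, hu]
  simp only [LinearMap.comp_apply, LinearEquiv.coe_coe, hc, hd, hv, map_sub, map_smul,
    smul_eq_mul]
  have h1 : _ = l (ofV x) := sum_formH_mul_apply v l u
  have h2 := sum_formH_mul_formH v u u
  have h3 : ∑ i, (l (ofV (v i)) -
        2 / formH V u u * formH V ((1 : ℂ) ⊗ₜ[ℝ] v i) u * l (ofV x)) ^ 2 =
      ∑ i, l (ofV (v i)) ^ 2 - 4 / formH V u u * l (ofV x) *
          ∑ i, formH V ((1 : ℂ) ⊗ₜ[ℝ] v i) u * l (ofV (v i)) +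
        4 / formH V u u ^ 2 * l (ofV x) ^ 2 *
          ∑ i, formH V ((1 : ℂ) ⊗ₜ[ℝ] v i) u * formH V ((1 : ℂ) ⊗ₜ[ℝ] v i) u := by
    rw [Finset.mul_sum, Finset.mul_sum, ← Finset.sum_sub_distrib, ← Finset.sum_add_distrib]
    exact Finset.sum_congr rfl fun i _ => by ring
  rw [h3, h1, h2]
  field_simp
  ring

/-! ### The subalgebra generated by c and C -/

/-- The values `(l(c), l(C))` of functionals `l` on `ĥ` exhaust `ℂ²`. -/
theorem exists_lift_eq [Nontrivial V] (a b : ℂ) : ∃ l : HHat V →ₗ[ℂ] ℂ,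
    SymmetricAlgebra.lift l (symC V) = a ∧ SymmetricAlgebra.lift l (casimir v) = b := by
  have hm : Nonempty (Fin m) := v.toBasis.index_nonempty
  obtain ⟨i⟩ := hm
  -- The functional takes the value t on one basis vector and 0 on the others and on d, so that l(C)
  -- = t² = b whatever a = l(c) is.
  obtain ⟨t, ht⟩ := IsAlgClosed.exists_pow_nat_eq b (n := 2) (by norm_num)
  refine ⟨t • (formH V ((1 : ℂ) ⊗ₜ[ℝ] v i)) ∘ₗ LinearMap.fst ℂ _ _ +
    a • LinearMap.fst ℂ _ _ ∘ₗ LinearMap.snd ℂ _ _, ?_, ?_⟩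
  · simp [lift_symC, cHat]
  · rw [lift_casimir, ← ht]
    simp [cHat, dHat, ofV, formH_one_tmul, v.inner_eq_ite, apply_ite, ite_pow]

theorem algebraicIndependent_symC_casimir [Nontrivial V] :
    AlgebraicIndependent ℂ ![symC V, casimir v] := by
  rw [algebraicIndependent_iff]
  intro p hp
  refine MvPolynomial.funext fun x => ?_
  obtain ⟨l, h1, h2⟩ := exists_lift_eq v (x 0) (x 1)
  have h3 : (SymmetricAlgebra.lift l).comp (MvPolynomial.aeval ![symC V, casimir v]) =
      MvPolynomial.aeval x := by
    refine MvPolynomial.algHom_ext fun i => ?_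
    fin_cases i <;> simp [h1, h2]
  have h4 := DFunLike.congr_fun h3 p
  rw [AlgHom.comp_apply, hp, map_zero] at h4
  simpa using h4.symm

/-- Every element of `ℂ[c, C]` is the sum of a multiple of `c` and a polynomial in `C`. -/
theorem exists_eq_symC_mul_add {p : SymmetricAlgebra ℂ (HHat V)}
    (hp : p ∈ Algebra.adjoin ℂ {symC V, casimir v}) :
    ∃ r ∈ Algebra.adjoin ℂ {symC V, casimir v}, ∃ g : Polynomial ℂ,
      p = symC V * r + Polynomial.aeval (casimir v) g := by
  have hC : ∀ g : Polynomial ℂ,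
      Polynomial.aeval (casimir v) g ∈ Algebra.adjoin ℂ {symC V, casimir v} := fun g =>
    Algebra.adjoin_mono (by simp) (Polynomial.aeval_mem_adjoin_singleton ℂ (casimir v))
  induction hp using Algebra.adjoin_induction with
  | mem x hx =>
    rcases hx with rfl | rfl
    · exact ⟨1, one_mem _, 0, by simp⟩
    · exact ⟨0, zero_mem _, Polynomial.X, by simp⟩
  | algebraMap r => exact ⟨0, zero_mem _, Polynomial.C r, by simp⟩
  | add x y _ _ hx hy =>
    obtain ⟨r, hr, g, rfl⟩ := hx
    obtain ⟨r', hr', g', rfl⟩ := hy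
    exact ⟨r + r', add_mem hr hr', g + g', by simp; ring⟩
  | mul x y hx' hy' hx hy =>
    obtain ⟨r, hr, g, rfl⟩ := hx
    obtain ⟨r', hr', g', rfl⟩ := hy
    exact ⟨r * (symC V * r' + Polynomial.aeval (casimir v) g') +
      Polynomial.aeval (casimir v) g * r',
      add_mem (mul_mem hr hy') (mul_mem (hC g) hr'), g * g', by simp; ring⟩

theorem symC_ne_zero [FiniteDimensional ℝ V] : symC V ≠ 0 := by
  intro h
  rw [symC, ← map_zero (SymmetricAlgebra.ι ℂ (HHat V))] at h
  simpa [cHat] using ι_injective h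

/-- Modulo c, an element of ℂ[c, C] is a polynomial g(C). If the element is divisible by c in S(ĥ),
then g vanishes at every value of C on the locus l(c) = 0, that is, on all of ℂ; so g = 0 and c
cancels. -/
theorem mem_adjoin_of_symC_mul_mem [FiniteDimensional ℝ V] [Nontrivial V]
    {p : SymmetricAlgebra ℂ (HHat V)}
    (hp : symC V * p ∈ Algebra.adjoin ℂ {symC V, casimir v}) :
    p ∈ Algebra.adjoin ℂ {symC V, casimir v} := by
  obtain ⟨r, hr, g, h⟩ := exists_eq_symC_mul_add v hp
  have hg : g = 0 := by
    refine Polynomial.funext fun b => ?_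
    obtain ⟨l, h1, h2⟩ := exists_lift_eq v 0 b
    have h3 := congrArg (SymmetricAlgebra.lift l) h
    rw [map_add, map_mul, map_mul, h1, zero_mul, zero_mul, zero_add,
      ← Polynomial.aeval_algHom_apply, h2] at h3
    simpa using h3.symm
  rw [hg, map_zero, add_zero] at h
  rwa [mul_left_cancel₀ symC_ne_zero h]

/-- The restriction of `p ∈ S(ĥ)` to the functionals vanishing on `h` with `l(d) = l(C) / 2 l(c)`
is, up to a power of `c`, given by an element of `ℂ[c, C]`. -/
theorem exists_mem_adjoin (p : SymmetricAlgebra ℂ (HHat V)) :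
    ∃ (N : ℕ), ∃ q ∈ Algebra.adjoin ℂ {symC V, casimir v}, ∀ l l' : HHat V →ₗ[ℂ] ℂ,
      l (cHat V) ≠ 0 → l' (cHat V) = l (cHat V) → (∀ u, l' (u, 0, 0) = 0) →
      l' (dHat V) = SymmetricAlgebra.lift l (casimir v) / (2 * l (cHat V)) →
      SymmetricAlgebra.lift l q = l (cHat V) ^ N * SymmetricAlgebra.lift l' p := by
  have hc : symC V ∈ Algebra.adjoin ℂ {symC V, casimir v} :=
    Algebra.subset_adjoin (by simp)
  have hC : casimir v ∈ Algebra.adjoin ℂ {symC V, casimir v} :=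
    Algebra.subset_adjoin (by simp)
  induction p using SymmetricAlgebra.induction with
  | algebraMap a =>
    refine ⟨0, algebraMap ℂ _ a, Subalgebra.algebraMap_mem _ a, fun l l' _ _ _ _ => ?_⟩
    simp [AlgHom.commutes]
  | ι x =>
    -- On such l' the vector x = u + ηc + ξd takes the value η l(c) + ξ l(C) / (2 l(c)); one factor
    -- of c clears the denominator.
    refine ⟨1, x.2.1 • symC V ^ 2 + (x.2.2 / 2) • casimir v,
      add_mem (Subalgebra.smul_mem _ (pow_mem hc 2) _) (Subalgebra.smul_mem _ hC _), ?_⟩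
    intro l l' h0 h1 h2 h3
    rw [SymmetricAlgebra.lift_ι_apply, congrArg l' (eq_add_smul_cHat_add_smul_dHat x)]
    simp only [map_add, map_smul, map_pow, h1, h2, h3, lift_symC, smul_eq_mul]
    field_simp
    ring
  | mul a b ha hb =>
    obtain ⟨N, q, hq, h⟩ := ha
    obtain ⟨N', q', hq', h'⟩ := hb
    refine ⟨N + N', q * q', mul_mem hq hq', fun l l' h0 h1 h2 h3 => ?_⟩
    rw [map_mul, map_mul, h l l' h0 h1 h2 h3, h' l l' h0 h1 h2 h3]
    ring
  | add a b ha hb =>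
    obtain ⟨N, q, hq, h⟩ := ha
    obtain ⟨N', q', hq', h'⟩ := hb
    refine ⟨N + N', symC V ^ N' * q + symC V ^ N * q',
      add_mem (mul_mem (pow_mem hc _) hq) (mul_mem (pow_mem hc _) hq'),
      fun l l' h0 h1 h2 h3 => ?_⟩
    rw [map_add, map_add, map_mul, map_mul, h l l' h0 h1 h2 h3, h' l l' h0 h1 h2 h3, map_pow,
      map_pow, lift_symC]
    ring

/-- The translations act on {l(c) ≠ 0} with a slice given by the functionals vanishing on h, so an
invariant is recovered from its restriction to that slice. -/
theorem mem_adjoin_of_forall_transl_mem_stab [FiniteDimensional ℝ V] [Nontrivial V]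
    {p : SymmetricAlgebra ℂ (HHat V)} (hp : ∀ u, transl u ∈ stab p) :
    p ∈ Algebra.adjoin ℂ {symC V, casimir v} := by
  obtain ⟨N, q, hq, h⟩ := exists_mem_adjoin v p
  -- The extra factor c makes the identity trivial at the functionals with l(c) = 0, where no slice
  -- is available.
  have key : symC V * (symC V ^ N * p) = symC V * q := by
    refine eq_of_forall_lift_eq fun l => ?_
    simp only [map_mul, map_pow, lift_symC]
    by_cases h0 : l (cHat V) = 0
    · simp [h0]
    congr 1
    -- Since t_u(v_i) = v_i - (v_i, u) c, this is the u for which l ∘ t_u vanishes on every v_i.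
    set u : ℂ ⊗[ℝ] V :=
      ∑ i, (l (ofV (v i)) / l (cHat V)) • ((1 : ℂ) ⊗ₜ[ℝ] v i) with hu
    have hvu (i : Fin m) : formH V ((1 : ℂ) ⊗ₜ[ℝ] v i) u = l (ofV (v i)) / l (cHat V) := by
      simp [hu, formH_one_tmul, v.inner_eq_ite, apply_ite]
    have huu := sum_formH_mul_formH v u u
    have hlu := sum_formH_mul_apply v l u
    simp only [hvu] at huu hlu
    have hl : SymmetricAlgebra.lift (l ∘ₗ (transl u).toLinearMap) p =
        SymmetricAlgebra.lift l p := by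
      rw [← lift_symAct, mem_stab.mp (hp u)]
    rw [← hl, h l (l ∘ₗ (transl u).toLinearMap) h0]
    · simp [transl_cHat]
    · intro w
      rw [← sum_formH_mul_apply v]
      refine Finset.sum_eq_zero fun i _ => ?_
      simp [transl_ofV, hvu, h0]
    -- With S = ∑ l(v_i)², the value at t_u(d) is l(d) + S / l(c) - S / (2 l(c)), which is l(C) / (2
    -- l(c)).
    · rw [lift_casimir]
      simp only [LinearMap.comp_apply, LinearEquiv.coe_coe, transl_dHat, map_sub, map_add,
        map_smul, smul_eq_mul, ← huu, ← hlu]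
      have e1 : ∑ i, l (ofV (v i)) / l (cHat V) * l (ofV (v i)) =
          (∑ i, l (ofV (v i)) ^ 2) / l (cHat V) := by
        rw [Finset.sum_div]
        exact Finset.sum_congr rfl fun i _ => by ring
      have e2 : ∑ i, l (ofV (v i)) / l (cHat V) * (l (ofV (v i)) / l (cHat V)) =
          (∑ i, l (ofV (v i)) ^ 2) / l (cHat V) ^ 2 := by
        rw [Finset.sum_div]
        exact Finset.sum_congr rfl fun i _ => by ring
      rw [e1, e2]
      field_simp
      ring
  have h1 := mul_left_cancel₀ symC_ne_zero key
  -- Only c^N p ∈ ℂ[c, C] is kept; the factors of c are removed one at a time.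
  clear h key
  rw [← h1] at hq
  clear h1
  induction N with
  | zero => simpa using hq
  | succ N ih =>
    rw [pow_succ', mul_assoc] at hq
    exact ih (mem_adjoin_of_symC_mul_mem v hq)

end Casimir

/-! ### Invariants of the extended affine Weyl group -/

namespace AffineRootDatum

variable {ι V : Type*} [NormedAddCommGroup V] [InnerProductSpace ℝ V] (D : AffineRootDatum ι V)

theorem mem_invariants_iff {p : SymmetricAlgebra ℂ (HHat V)} :
    p ∈ D.invariants ↔ D.extAffWeyl ≤ stab p := Iff.rfl

theorem nontrivial (D : AffineRootDatum ι V) : Nontrivial V := by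
  have := D.isIrreducible.nontrivial
  exact D.Vs.subtype_injective.nontrivial

theorem mem_invariants_of_refl_of_transl {p : SymmetricAlgebra ℂ (HHat V)}
    (h1 : ∀ (x : V) (hx : formHat V (ofV x) (ofV x) ≠ 0), refl (ofV x) hx ∈ stab p)
    (h2 : ∀ u, transl u ∈ stab p) : p ∈ D.invariants := by
  rw [mem_invariants_iff, extAffWeyl, weyl, translations, sup_le_iff, Subgroup.closure_le,
    Subgroup.closure_le]
  constructor
  · rintro _ ⟨i, rfl⟩
    exact h1 _ _
  · rintro _ ⟨y, -, rfl⟩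
    exact h2 _

/-- `S(ĥ)^{Ŵ^Y} = ℂ[c, C]` for a full lattice `Y`. -/
theorem invariants_eq_adjoin [FiniteDimensional ℝ V]
    (hY : Submodule.span ℝ (D.Y : Set V) = ⊤) {m : ℕ} (v : OrthonormalBasis (Fin m) ℝ V) :
    D.invariants = Algebra.adjoin ℂ {symC V, casimir v} := by
  have := D.nontrivial
  refine le_antisymm (fun p hp => ?_) (Algebra.adjoin_le ?_)
  · refine mem_adjoin_of_forall_transl_mem_stab v (transl_mem_stab hY fun y hy => ?_)
    exact D.mem_invariants_iff.mp hp
      (Subgroup.mem_sup_right (Subgroup.subset_closure ⟨y, hy, rfl⟩))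
  · rintro p (rfl | rfl)
    · exact D.mem_invariants_of_refl_of_transl refl_mem_stab_symC transl_mem_stab_symC
    · exact D.mem_invariants_of_refl_of_transl (refl_mem_stab_casimir v)
        (transl_mem_stab_casimir v)

end AffineRootDatum


/-! ### Generation of the extended affine Weyl group -/

section

variable {V : Type*} [NormedAddCommGroup V] [InnerProductSpace ℝ V]

theorem ofV_add (x y : V) : ofV (x + y) = ofV x + ofV y := by
  simp [ofV, TensorProduct.tmul_add]

theorem ofV_neg (x : V) : ofV (-x) = -ofV x := by
  simp [ofV, TensorProduct.tmul_neg]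

theorem ofV_zero : ofV (0 : V) = 0 := by
  simp [ofV]

theorem ofV_smul (r : ℝ) (x : V) : ofV (r • x) = (r : ℂ) • ofV x := by
  rw [ofV, ← TensorProduct.smul_tmul]
  refine Prod.ext ?_ (Prod.ext ?_ ?_)
  · simp [ofV, TensorProduct.smul_tmul']
  · simp [ofV]
  · simp [ofV]

theorem one_tmul_injective : Function.Injective fun x : V => (1 : ℂ) ⊗ₜ[ℝ] x := by
  intro x y h
  have h1 : (1 : ℂ) ⊗ₜ[ℝ] (x - y) = 0 := by
    rw [TensorProduct.tmul_sub]
    exact sub_eq_zero.mpr h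
  have h2 := formH_one_tmul (x - y) (x - y)
  rw [h1] at h2
  simp only [map_zero] at h2
  exact sub_eq_zero.mp (inner_self_eq_zero.mp (by exact_mod_cast h2.symm))

theorem refl_refl (a : HHat V) (ha : formHat V a a ≠ 0) (x : HHat V) :
    refl a ha (refl a ha x) = x := by
  have h (y : HHat V) : refl a ha y = y - (2 / formHat V a a * formHat V y a) • a := by
    rw [refl_apply, map_smul, smul_eq_mul]
  rw [h, h, map_sub, map_smul, LinearMap.sub_apply, LinearMap.smul_apply, smul_eq_mul]
  generalize formHat V x a = t
  have : 2 / formHat V a a * (t - 2 / formHat V a a * t * formHat V a a) =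
      -(2 / formHat V a a * t) := by
    field_simp
    ring
  rw [this, neg_smul]
  abel

theorem refl_mul_self (a : HHat V) (ha : formHat V a a ≠ 0) : refl a ha * refl a ha = 1 :=
  LinearEquiv.ext (refl_refl a ha)

/-- The additive monoid spanned by a set of vectors `S` on which a functional takes the value `1`,
except possibly on a vector `a` in the kernel. -/
theorem exists_apply_eq_of_mem_closure {S : Set (HHat V)} {a : HHat V} {φ : HHat V →ₗ[ℂ] ℂ}
    (ha : φ a = 0) (hφ : ∀ x ∈ S, x ≠ a → φ x = 1) {b : HHat V}
    (hb : b ∈ AddSubmonoid.closure S) :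
    ∃ n : ℕ, φ b = n ∧ (n = 0 → ∃ k : ℕ, b = k • a) := by
  induction hb using AddSubmonoid.closure_induction with
  | mem x hx =>
    by_cases h : x = a
    · exact ⟨0, by simp [h, ha], fun _ => ⟨1, by simp [h]⟩⟩
    · exact ⟨1, by simp [hφ x hx h], fun h => by simp at h⟩
  | zero => exact ⟨0, by simp, fun _ => ⟨0, by simp⟩⟩
  | add x y _ _ hx hy =>
    obtain ⟨n, hn, hn'⟩ := hx
    obtain ⟨k, hk, hk'⟩ := hy
    refine ⟨n + k, by simp [hn, hk], fun h => ?_⟩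
    obtain ⟨p, rfl⟩ := hn' (by omega)
    obtain ⟨q, rfl⟩ := hk' (by omega)
    exact ⟨p + q, by rw [add_smul]⟩

/-- If `b` and `-s(b)` belong to such a monoid, where `s(b) - b` is in the kernel, then `b` is a
multiple of `a`. -/
theorem exists_eq_nsmul_of_mem_closure {S : Set (HHat V)} {a : HHat V} {φ : HHat V →ₗ[ℂ] ℂ}
    (ha : φ a = 0) (hφ : ∀ x ∈ S, x ≠ a → φ x = 1) {b b' : HHat V}
    (hb : b ∈ AddSubmonoid.closure S) (hb' : -b' ∈ AddSubmonoid.closure S) (h : φ b' = φ b) :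
    ∃ k : ℕ, b = k • a := by
  obtain ⟨n, hn, hn'⟩ := exists_apply_eq_of_mem_closure ha hφ hb
  obtain ⟨k, hk, -⟩ := exists_apply_eq_of_mem_closure ha hφ hb'
  rw [map_neg, h, hn] at hk
  -- The values n = φ(b) and k = -φ(b) are both natural numbers, so both vanish.
  have h0 : ((n + k : ℕ) : ℂ) = 0 := by push_cast; rw [← hk]; ring
  exact hn' (by have := Nat.cast_eq_zero.mp h0; omega)

end

/-! ### Affine roots, positivity and simple reflections -/

namespace AffineRootDatum

variable {ι V : Type*} [NormedAddCommGroup V] [InnerProductSpace ℝ V] (D : AffineRootDatum ι V)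

/-- The vector `α + m c`. -/
noncomputable def affVec (i : ι) (m : ℤ) : HHat V := ofV (D.root i) + (m : ℂ) • cHat V

theorem affVec_mem (i : ι) (m : ℤ) : D.affVec i m ∈ D.affRoots := ⟨i, m, rfl⟩

theorem affVec_zero (i : ι) : D.affVec i 0 = ofV (D.root i) := by simp [affVec]

theorem ne_zero_of_mem_affRoots {a : HHat V} (ha : a ∈ D.affRoots) : a ≠ 0 := by
  rintro rfl
  exact D.formHat_self_ne_zero ⟨0, ha⟩ (by simp)

theorem root_reflectionPerm (i j : ι) : D.root (D.P.reflectionPerm i j) =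
    D.root j - (2 * ⟪D.root j, D.root i⟫_ℝ / ⟪D.root i, D.root i⟫_ℝ) • D.root i := by
  rw [root, D.P.root_reflectionPerm, D.P.reflection_apply]
  rw [show D.P.coroot' i (D.P.root j) = D.P.toLinearMap (D.P.root j) (D.P.coroot i) from rfl,
    D.pairing_coroot]
  rfl

theorem root_reflectionPerm_self (i : ι) : D.root (D.P.reflectionPerm i i) = -D.root i := by
  rw [root_reflectionPerm, mul_div_assoc, div_self (D.inner_root_ne_zero i), mul_one, two_smul]
  abel

theorem neg_affVec (i : ι) (m : ℤ) :
    -D.affVec i m = D.affVec (D.P.reflectionPerm i i) (-m) := by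
  rw [affVec, affVec, root_reflectionPerm_self, ofV_neg]
  simp
  abel

theorem affRefl_root_root (i j : ι) :
    D.affRefl ⟨ofV (D.root i), D.ofV_root_mem i⟩ (ofV (D.root j)) =
      ofV (D.root (D.P.reflectionPerm i j)) := by
  have h1 (x y : V) : formHat V (ofV x) (ofV y) = ((⟪x, y⟫_ℝ : ℝ) : ℂ) := by
    simp [formHat_apply, ofV, formH_one_tmul]
  rw [affRefl, refl_apply, root_reflectionPerm, sub_eq_add_neg, sub_eq_add_neg, ofV_add, ofV_neg,
    ofV_smul, map_smul, h1, h1]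
  congr 3
  simp
  ring

/-- The subgroup of the elements of `GL(ĥ)` that fix `c` and preserve the affine roots. -/
def affRootsStab : Subgroup (HHat V ≃ₗ[ℂ] HHat V) where
  carrier := {w | w (cHat V) = cHat V ∧ ∀ x, w x ∈ D.affRoots ↔ x ∈ D.affRoots}
  mul_mem' {w w'} h h' := ⟨by rw [LinearEquiv.mul_apply, h'.1, h.1],
    fun x => by rw [LinearEquiv.mul_apply, h.2, h'.2]⟩
  one_mem' := ⟨rfl, fun _ => Iff.rfl⟩
  inv_mem' {w} h := by
    have h1 (x) : w (w⁻¹ x) = x := w.apply_symm_apply x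
    refine ⟨w.injective ?_, fun x => ?_⟩
    · rw [h1, h.1]
    · rw [← h.2, h1]

/-- A map fixing c preserves R + ℤc as soon as it sends the finite roots into it; applying this to
w' as well gives the reverse implication. -/
theorem mem_affRootsStab {w w' : HHat V ≃ₗ[ℂ] HHat V} (hw : w' * w = 1)
    (h1 : w (cHat V) = cHat V) (h1' : w' (cHat V) = cHat V)
    (h2 : ∀ i, w (ofV (D.root i)) ∈ D.affRoots) (h2' : ∀ i, w' (ofV (D.root i)) ∈ D.affRoots) :
    w ∈ D.affRootsStab := by
  have key (w : HHat V ≃ₗ[ℂ] HHat V) (h1 : w (cHat V) = cHat V)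
      (h2 : ∀ i, w (ofV (D.root i)) ∈ D.affRoots) (x) (hx : x ∈ D.affRoots) :
      w x ∈ D.affRoots := by
    obtain ⟨i, m, rfl⟩ := hx
    obtain ⟨j, k, h⟩ := h2 i
    refine ⟨j, k + m, ?_⟩
    rw [map_add, map_smul, h1, h]
    push_cast
    rw [add_smul]
    abel
  refine ⟨h1, fun x => ⟨fun h => ?_, key w h1 h2 x⟩⟩
  have := key w' h1' h2' _ h
  rwa [← LinearEquiv.mul_apply, hw] at this

theorem extAffWeyl_le_affRootsStab : D.extAffWeyl ≤ D.affRootsStab := by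
  rw [extAffWeyl, weyl, translations, sup_le_iff, Subgroup.closure_le, Subgroup.closure_le]
  constructor
  · rintro _ ⟨i, rfl⟩
    have h1 : D.affRefl ⟨ofV (D.root i), D.ofV_root_mem i⟩ (cHat V) = cHat V := by
      simp [affRefl, refl_apply, formHat_apply, ofV, cHat]
    have h2 (j) : D.affRefl ⟨ofV (D.root i), D.ofV_root_mem i⟩ (ofV (D.root j)) ∈ D.affRoots := by
      rw [affRefl_root_root]
      exact D.ofV_root_mem _
    exact D.mem_affRootsStab (refl_mul_self _ _) h1 h1 h2 h2
  · rintro _ ⟨y, hy, rfl⟩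
    have h2 (y) (hy : y ∈ D.Y) (i) :
        transl ((1 : ℂ) ⊗ₜ[ℝ] y) (ofV (D.root i)) ∈ D.affRoots := by
      obtain ⟨n, hn⟩ := D.inner_root_int y hy i
      refine ⟨i, -n, ?_⟩
      rw [transl_ofV, formH_one_tmul, real_inner_comm, root, hn]
      simp [sub_eq_add_neg]
    refine D.mem_affRootsStab (w' := transl ((1 : ℂ) ⊗ₜ[ℝ] (-y))) ?_ (transl_cHat _)
      (transl_cHat _) (h2 y hy) (h2 _ (neg_mem hy))
    rw [← transl_add, ← TensorProduct.tmul_add, neg_add_cancel, TensorProduct.tmul_zero]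
    ext x : 1
    rw [transl_apply]
    simp

theorem apply_mem_affRoots (w : D.extAffWeyl) {a : HHat V} (ha : a ∈ D.affRoots) :
    (w : HHat V ≃ₗ[ℂ] HHat V) a ∈ D.affRoots :=
  ((D.extAffWeyl_le_affRootsStab w.2).2 a).mpr ha

theorem apply_cHat (w : D.extAffWeyl) : (w : HHat V ≃ₗ[ℂ] HHat V) (cHat V) = cHat V :=
  (D.extAffWeyl_le_affRootsStab w.2).1

theorem ofV_mem_closure {x : D.Vs}
    (hx : x ∈ AddSubmonoid.closure (D.P.root '' D.base.support)) :
    ofV (x : V) ∈ AddSubmonoid.closure D.simpleAffRoots := by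
  induction hx using AddSubmonoid.closure_induction with
  | mem x hx =>
    obtain ⟨i, hi, rfl⟩ := hx
    exact AddSubmonoid.subset_closure (Or.inr ⟨i, hi, rfl⟩)
  | zero => simp [ofV_zero]
  | add x y _ _ hx hy =>
    rw [Submodule.coe_add, ofV_add]
    exact add_mem hx hy

theorem ofV_highest_mem_closure :
    ofV (D.root D.θ) ∈ AddSubmonoid.closure D.simpleAffRoots := by
  have : Nonempty ι := ⟨D.θ⟩
  obtain ⟨i, hi⟩ := D.base.support_nonempty
  refine D.ofV_mem_closure (x := D.P.root D.θ) ?_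
  rw [← sub_add_cancel (D.P.root D.θ) (D.P.root i)]
  exact add_mem (D.highest i) (AddSubmonoid.subset_closure ⟨i, hi, rfl⟩)

/-- For m > 0, α + mc = m(-θ + c) + (m - 1)θ + (θ + α). The last term is θ - (-α), a sum of simple
roots since θ is highest and -α is a root. -/
theorem affVec_mem_posAffRoots (i : ι) {m : ℤ} (hm : 0 < m) :
    D.affVec i m ∈ D.posAffRoots := by
  refine ⟨D.affVec_mem i m, ?_⟩
  obtain ⟨n, rfl⟩ : ∃ n : ℕ, m = n + 1 := ⟨(m - 1).toNat, by omega⟩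
  have h1 := D.ofV_mem_closure (D.highest (D.P.reflectionPerm i i))
  have h2 := D.ofV_highest_mem_closure
  have h3 : -ofV (D.root D.θ) + cHat V ∈ AddSubmonoid.closure D.simpleAffRoots :=
    AddSubmonoid.subset_closure (Or.inl rfl)
  have h4 : D.affVec i (n + 1) = (n + 1) • (-ofV (D.root D.θ) + cHat V) + n • ofV (D.root D.θ) +
      ofV ((D.P.root D.θ - D.P.root (D.P.reflectionPerm i i) : D.Vs) : V) := by
    have h5 : ((D.P.root D.θ - D.P.root (D.P.reflectionPerm i i) : D.Vs) : V) =
        D.root D.θ + D.root i := by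
      have := D.root_reflectionPerm_self i
      simp only [root] at this ⊢
      rw [Submodule.coe_sub, this, sub_neg_eq_add]
    rw [h5, ofV_add, affVec]
    push_cast
    module
  rw [h4]
  exact add_mem (add_mem (nsmul_mem h3 _) (nsmul_mem h2 _)) h1

/-- An affine root is positive or negative. -/
theorem mem_posAffRoots_or_neg_mem {a : HHat V} (ha : a ∈ D.affRoots) :
    a ∈ D.posAffRoots ∨ -a ∈ D.posAffRoots := by
  obtain ⟨i, m, rfl⟩ := ha
  change D.affVec i m ∈ _ ∨ -D.affVec i m ∈ _
  rcases lt_trichotomy m 0 with hm | rfl | hm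
  · right
    rw [neg_affVec]
    exact D.affVec_mem_posAffRoots _ (by omega)
  · rcases D.base.root_mem_or_neg_mem i with h | h
    · left
      exact ⟨D.affVec_mem _ _, by rw [affVec_zero]; exact D.ofV_mem_closure h⟩
    · right
      refine ⟨by rw [neg_affVec]; exact D.affVec_mem _ _, ?_⟩
      rw [affVec_zero, ← ofV_neg]
      exact D.ofV_mem_closure h
  · exact Or.inl (D.affVec_mem_posAffRoots i hm)

theorem simpleAffRoots_subset : D.simpleAffRoots ⊆ D.affRoots := by
  rintro _ (rfl | ⟨i, -, rfl⟩)
  · refine ⟨D.P.reflectionPerm D.θ D.θ, 1, ?_⟩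
    rw [root_reflectionPerm_self, ofV_neg]
    simp
  · exact D.ofV_root_mem i

/-- The simple roots are linearly independent and only a_0 involves c, so values on the simple
affine roots can be prescribed freely: first on V, then on c to adjust a_0. -/
theorem exists_functional (f : ι → ℂ) (e : ℂ) : ∃ φ : HHat V →ₗ[ℂ] ℂ,
    (∀ i ∈ D.base.support, φ (ofV (D.root i)) = f i) ∧
      φ (-ofV (D.root D.θ) + cHat V) = e := by
  have hli : LinearIndependent ℝ fun i : D.base.support => D.root i :=
    LinearIndependent.map' D.base.linearIndepOn_root D.Vs.subtype D.Vs.ker_subtype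
  obtain ⟨g, hg⟩ := LinearMap.exists_extend
    ((Module.Basis.span hli).constr ℝ fun i : D.base.support => f i)
  have hgi (i) (hi : i ∈ D.base.support) : g (D.root i) = f i := by
    have h1 := DFunLike.congr_fun hg (Module.Basis.span hli ⟨i, hi⟩)
    rw [Module.Basis.constr_basis, LinearMap.comp_apply, Submodule.subtype_apply,
      Module.Basis.span_apply] at h1
    exact h1
  refine ⟨LinearMap.liftBaseChange ℂ g ∘ₗ LinearMap.fst ℂ _ _ +
    (e + g (D.root D.θ)) • LinearMap.fst ℂ _ _ ∘ₗ LinearMap.snd ℂ _ _, fun i hi => ?_, ?_⟩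
  · simp [ofV, hgi i hi]
  · simp [ofV, cHat]

/-- For a simple affine root `a` there is a functional that vanishes at `a` and equals `1` at all
other simple affine roots. -/
theorem exists_functional_of_mem_simpleAffRoots {a : HHat V} (ha : a ∈ D.simpleAffRoots) :
    ∃ φ : HHat V →ₗ[ℂ] ℂ, φ a = 0 ∧ ∀ x ∈ D.simpleAffRoots, x ≠ a → φ x = 1 := by
  classical
  rcases ha with rfl | ⟨j, hj, rfl⟩
  · obtain ⟨φ, h1, h2⟩ := D.exists_functional (fun _ => 1) 0
    refine ⟨φ, h2, ?_⟩
    rintro _ (rfl | ⟨i, hi, rfl⟩) hx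
    · exact (hx rfl).elim
    · exact h1 i hi
  · obtain ⟨φ, h1, h2⟩ := D.exists_functional (fun i => if i = j then 0 else 1) 1
    refine ⟨φ, by simp [h1 j hj], ?_⟩
    rintro _ (rfl | ⟨i, hi, rfl⟩) hx
    · exact h2
    · have : i ≠ j := by rintro rfl; exact hx rfl
      simp [h1 i hi, this]

/-- The height functional, equal to 1 on each simple affine root, would be nonnegative on both a and
-a, forcing a = 0. -/
theorem neg_notMem_posAffRoots {a : HHat V} (ha : a ∈ D.posAffRoots) : -a ∉ D.posAffRoots := by
  intro h
  obtain ⟨φ, h1, h2⟩ := D.exists_functional (fun _ => 1) 1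
  obtain ⟨k, hk⟩ := exists_eq_nsmul_of_mem_closure (a := 0) (map_zero φ) (by
    rintro _ (rfl | ⟨i, hi, rfl⟩) -
    · exact h2
    · exact h1 i hi) ha.2 h.2 rfl
  exact D.ne_zero_of_mem_affRoots ha.1 (by simpa using hk)

theorem eq_of_eq_nsmul {a b : HHat V} (ha : a ∈ D.affRoots) (hb : b ∈ D.affRoots) {k : ℕ}
    (h : b = k • a) : b = a := by
  obtain ⟨i, m, rfl⟩ := ha
  obtain ⟨j, m', rfl⟩ := hb
  have h1 : (D.root j) = (k : ℝ) • D.root i := by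
    refine one_tmul_injective ?_
    have h2 := congrArg Prod.fst h
    simp only [ofV, cHat, Prod.fst_add, Prod.smul_fst, smul_zero, add_zero] at h2
    simp only [h2, Nat.cast_smul_eq_nsmul, TensorProduct.tmul_smul]
  have h0 : D.root i ≠ 0 := fun h => D.inner_root_ne_zero i (by simp [h])
  have h2 : D.P.root j = (k : ℝ) • D.P.root i := Subtype.ext h1
  -- Proportional roots of a reduced system agree up to sign, and k ≥ 0 excludes the minus sign.
  have h3 : D.root i = D.root j ∨ D.root i = -D.root j := by
    rcases D.isReduced.eq_or_eq_neg i j (fun h => by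
      have h4 := (LinearIndependent.pair_iff.mp h) (k : ℝ) (-1) (by rw [h2]; module)
      norm_num at h4) with h | h
    · exact Or.inl (congrArg Subtype.val h)
    · exact Or.inr (congrArg Subtype.val h)
  have hk : k = 1 := by
    rcases h3 with h3 | h3
    · rw [h1] at h3
      have := smul_left_injective ℝ h0 ((one_smul ℝ _).trans h3)
      exact_mod_cast this.symm
    · rw [h1, ← neg_smul] at h3
      have := smul_left_injective ℝ h0 ((one_smul ℝ _).trans h3)
      have h5 : (0 : ℝ) ≤ k := k.cast_nonneg
      have h6 : (1 : ℝ) = -k := this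
      linarith
  rw [h, hk, one_smul]

/-- A simple affine reflection `s_a` permutes the positive affine roots other than `a`. -/
theorem affRefl_mem_posAffRoots {a : D.affRoots} (ha : (a : HHat V) ∈ D.simpleAffRoots)
    {b : HHat V} (hb : b ∈ D.posAffRoots) (hab : b ≠ a) : D.affRefl a b ∈ D.posAffRoots := by
  have h1 : D.affRefl a b ∈ D.affRoots := D.apply_mem_affRoots (D.s a) hb.1
  by_contra h2
  have h3 := (D.mem_posAffRoots_or_neg_mem h1).resolve_left h2
  obtain ⟨φ, hφ, hφ'⟩ := D.exists_functional_of_mem_simpleAffRoots ha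
  -- The reflection changes b by a multiple of a, on which φ vanishes; so b and -s_a(b) cannot both
  -- be positive unless b is a multiple of a.
  obtain ⟨k, hk⟩ := exists_eq_nsmul_of_mem_closure hφ hφ' hb.2 h3.2 (by
    rw [affRefl, refl_apply]
    simp [hφ])
  exact hab (D.eq_of_eq_nsmul a.2 hb.1 hk)

theorem affRefl_affRefl (a : D.affRoots) (x : HHat V) : D.affRefl a (D.affRefl a x) = x :=
  refl_refl _ (D.formHat_self_ne_zero a) x

theorem affRefl_self (a : D.affRoots) : D.affRefl a a = -(a : HHat V) := by
  rw [affRefl, refl_apply, map_smul, smul_eq_mul,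
    div_mul_cancel₀ _ (D.formHat_self_ne_zero a), two_smul]
  abel

theorem s_mul_s (a : D.affRoots) : D.s a * D.s a = 1 :=
  Subtype.ext (refl_mul_self _ (D.formHat_self_ne_zero a))

/-! ### Inversions and generation by Ω and simple reflections -/

/-- The positive affine roots that become negative under `w`. -/
def inversions (w : D.extAffWeyl) : Set (HHat V) :=
  {b | b ∈ D.posAffRoots ∧ (w : HHat V ≃ₗ[ℂ] HHat V) b ∉ D.posAffRoots}

theorem exists_nat_of_mem_closure {b : HHat V}
    (hb : b ∈ AddSubmonoid.closure D.simpleAffRoots) : ∃ n : ℕ, b.2.1 = n := by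
  induction hb using AddSubmonoid.closure_induction with
  | mem x hx =>
    rcases hx with rfl | ⟨i, -, rfl⟩
    · exact ⟨1, by simp [ofV, cHat]⟩
    · exact ⟨0, by simp [ofV]⟩
  | zero => exact ⟨0, by simp⟩
  | add x y _ _ hx hy =>
    obtain ⟨n, hn⟩ := hx
    obtain ⟨k, hk⟩ := hy
    exact ⟨n + k, by simp [hn, hk]⟩

/-- If w(α) = β + kc, then w(α + mc) = β + (k + m)c. Positivity of α + mc forces m ≥ 0, and
non-positivity of its image forces m ≤ -k, leaving finitely many m for each of the finitely many α.
-/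
theorem finite_inversions [Finite ι] (w : D.extAffWeyl) : (D.inversions w).Finite := by
  have h (i : ι) : ∃ j : ι, ∃ k : ℤ,
      (w : HHat V ≃ₗ[ℂ] HHat V) (ofV (D.root i)) = ofV (D.root j) + (k : ℂ) • cHat V :=
    D.apply_mem_affRoots w (D.ofV_root_mem i)
  choose j k hjk using h
  refine (Set.finite_iUnion fun i =>
    (Set.finite_Icc (0 : ℤ) (-k i)).image (D.affVec i)).subset ?_
  rintro b ⟨hb, hb'⟩
  obtain ⟨i, m, rfl⟩ := hb.1
  refine Set.mem_iUnion.mpr ⟨i, m, ⟨?_, ?_⟩, rfl⟩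
  · obtain ⟨n, hn⟩ := D.exists_nat_of_mem_closure hb.2
    have : (m : ℂ) = ((n : ℤ) : ℂ) := by simpa [ofV, cHat] using hn
    rw [Int.cast_inj] at this
    omega
  · by_contra hm
    refine hb' ?_
    have : (w : HHat V ≃ₗ[ℂ] HHat V) (ofV (D.root i) + (m : ℂ) • cHat V) =
        D.affVec (j i) (k i + m) := by
      rw [map_add, map_smul, D.apply_cHat, hjk, affVec]
      push_cast
      module
    rw [this]
    exact D.affVec_mem_posAffRoots _ (by omega)

/-- The reflection s_a maps the inversions of w s_a injectively into those of w and misses a, whose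
preimage -a is not positive. -/
theorem ncard_inversions_mul_lt [Finite ι] (w : D.extAffWeyl) {a : D.affRoots}
    (ha : (a : HHat V) ∈ D.simpleAffRoots)
    (hwa : (w : HHat V ≃ₗ[ℂ] HHat V) a ∉ D.posAffRoots) :
    (D.inversions (w * D.s a)).ncard < (D.inversions w).ncard := by
  have ha' : (a : HHat V) ∈ D.posAffRoots := ⟨a.2, AddSubmonoid.subset_closure ha⟩
  rw [← Set.ncard_image_of_injective _ (D.affRefl a).injective]
  refine Set.ncard_lt_ncard ?_ (D.finite_inversions w)
  rw [Set.ssubset_iff_of_subset]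
  · refine ⟨a, ⟨ha', hwa⟩, ?_⟩
    rintro ⟨b, hb, hba⟩
    have : b = -a := by rw [← D.affRefl_affRefl a b, hba, affRefl_self]
    exact D.neg_notMem_posAffRoots ha' (this ▸ hb.1)
  · rintro _ ⟨b, hb, rfl⟩
    have hb2 : (w : HHat V ≃ₗ[ℂ] HHat V) (D.affRefl a b) ∉ D.posAffRoots := hb.2
    refine ⟨D.affRefl_mem_posAffRoots ha hb.1 ?_, hb2⟩
    rintro rfl
    rw [affRefl_self, map_neg] at hb2
    exact hb2 ((D.mem_posAffRoots_or_neg_mem (D.apply_mem_affRoots w a.2)).resolve_left hwa)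

theorem mem_Omega_of_forall {w : D.extAffWeyl}
    (h : ∀ a ∈ D.simpleAffRoots, (w : HHat V ≃ₗ[ℂ] HHat V) a ∈ D.posAffRoots) : w ∈ D.Omega := by
  rintro b ⟨hb, hb'⟩
  refine ⟨D.apply_mem_affRoots w hb, ?_⟩
  clear hb
  induction hb' using AddSubmonoid.closure_induction with
  | mem x hx => exact (h x hx).2
  | zero => rw [map_zero]; exact zero_mem _
  | add x y _ _ hx hy => rw [map_add]; exact add_mem hx hy

/-- The elements of `Ŵ^Y` of the form `ω s_{a_1} ⋯ s_{a_n}` with `ω ∈ Ω` and simple affine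
roots `a_i`. -/
inductive IsWord : ℕ → D.extAffWeyl → Prop
  | omega (w : D.extAffWeyl) : w ∈ D.Omega → IsWord 0 w
  | mul_s (n : ℕ) (w : D.extAffWeyl) (a : D.affRoots) :
      (a : HHat V) ∈ D.simpleAffRoots → IsWord n w → IsWord (n + 1) (w * D.s a)

/-- `Ŵ^Y` is generated by `Ω` and the simple affine reflections. -/
theorem exists_isWord [Finite ι] (w : D.extAffWeyl) : ∃ n, D.IsWord n w := by
  induction hN : (D.inversions w).ncard using Nat.strong_induction_on generalizing w with
  | _ N ih =>
    by_cases hw : w ∈ D.Omega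
    · exact ⟨0, .omega w hw⟩
    · obtain ⟨a, ha, hwa⟩ : ∃ a ∈ D.simpleAffRoots,
          (w : HHat V ≃ₗ[ℂ] HHat V) a ∉ D.posAffRoots := by
        by_contra! h
        exact hw (D.mem_Omega_of_forall h)
      let a' : D.affRoots := ⟨a, D.simpleAffRoots_subset ha⟩
      obtain ⟨n, hn⟩ := ih _ (hN ▸ D.ncard_inversions_mul_lt w (a := a') ha hwa) _ rfl
      refine ⟨n + 1, ?_⟩
      -- The word found for w s_a is multiplied by s_a once more to recover w.
      have := IsWord.mul_s n _ a' ha hn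
      rwa [mul_assoc, s_mul_s, mul_one] at this

end AffineRootDatum


namespace AffineRootDatum

variable {ι V : Type*} [NormedAddCommGroup V] [InnerProductSpace ℝ V] (D : AffineRootDatum ι V)

/-! ### The length function -/

/-- The least number of simple affine reflections in an expression `ω s_{a_1} ⋯ s_{a_n}`. -/
noncomputable def len (w : D.extAffWeyl) : ℕ := sInf {n | D.IsWord n w}

theorem len_le {n : ℕ} {w : D.extAffWeyl} (h : D.IsWord n w) : D.len w ≤ n := Nat.sInf_le h

/-- Every element has some word, so the infimum is attained and is never the default value 0 of an
empty set. -/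
theorem isWord_len [Finite ι] (w : D.extAffWeyl) : D.IsWord (D.len w) w :=
  Nat.sInf_mem (D.exists_isWord w)

theorem len_mul_s_le [Finite ι] (w : D.extAffWeyl) {a : D.affRoots}
    (ha : (a : HHat V) ∈ D.simpleAffRoots) : D.len (w * D.s a) ≤ D.len w + 1 :=
  D.len_le (.mul_s _ _ _ ha (D.isWord_len w))

theorem len_one : D.len 1 = 0 :=
  Nat.le_zero.mp (D.len_le (.omega 1 fun _ h => h))

namespace ExtTrigCherednik

variable {D} {k : D.affRoots → ℂ} {H : Type*} [Ring H] [Algebra ℂ H] (A : D.ExtTrigCherednik k H)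

/-! ### Normal forms in the Cherednik algebra -/

/-- The image in `Ĥ^Y(k)` of an element of `Ŵ^Y`. -/
noncomputable def T (w : D.extAffWeyl) : H := A.ofGrp (MonoidAlgebra.of ℂ _ w)

theorem T_mul (w w' : D.extAffWeyl) : A.T (w * w') = A.T w * A.T w' := by
  simp only [T, map_mul]

theorem T_one : A.T 1 = 1 := by simp only [T, map_one]

/-- The linear map `∑ p_w [w] ↦ ∑ p_w w`. -/
noncomputable def ofFinsupp : (D.extAffWeyl →₀ SymmetricAlgebra ℂ (HHat V)) →ₗ[ℂ] H :=
  Finsupp.lsum ℂ fun w => LinearMap.mulRight ℂ (A.T w) ∘ₗ A.ofSym.toLinearMap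

theorem ofFinsupp_single (w : D.extAffWeyl) (p : SymmetricAlgebra ℂ (HHat V)) :
    A.ofFinsupp (Finsupp.single w p) = A.ofSym p * A.T w := by
  simp [ofFinsupp]

theorem ofFinsupp_apply (f : D.extAffWeyl →₀ SymmetricAlgebra ℂ (HHat V)) :
    A.ofFinsupp f = ∑ w ∈ f.support, A.ofSym (f w) * A.T w := by
  simp [ofFinsupp, Finsupp.sum]

theorem ofFinsupp_surjective : Function.Surjective A.ofFinsupp := by
  rw [← LinearMap.range_eq_top, eq_top_iff]
  rintro h -
  obtain ⟨t, rfl⟩ := A.mul_bijective.2 h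
  induction t using TensorProduct.induction_on with
  | zero => rw [map_zero]; exact zero_mem _
  | add x y hx hy => rw [map_add]; exact add_mem hx hy
  | tmul p x =>
    induction x using MonoidAlgebra.induction_linear with
    | zero => rw [TensorProduct.tmul_zero, map_zero]; exact zero_mem _
    | add x y hx hy => rw [TensorProduct.tmul_add, map_add]; exact add_mem hx hy
    | single w r =>
      refine ⟨Finsupp.single w (r • p), ?_⟩
      have : MonoidAlgebra.single w r = r • MonoidAlgebra.of ℂ D.extAffWeyl w := by
        simp [MonoidAlgebra.of_apply]
      rw [ofFinsupp_single, this, TensorProduct.tmul_smul, map_smul]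
      simp [T]

/-- The coefficient of `w` in the normal form `∑ p_w w` of an element of `Ĥ^Y(k)`. -/
noncomputable def coeff (w : D.extAffWeyl) : H →ₗ[ℂ] SymmetricAlgebra ℂ (HHat V) :=
  (TensorProduct.rid ℂ (SymmetricAlgebra ℂ (HHat V))).toLinearMap ∘ₗ
    LinearMap.lTensor (SymmetricAlgebra ℂ (HHat V))
      (Finsupp.lapply w ∘ₗ (MonoidAlgebra.coeffLinearEquiv ℂ).toLinearMap) ∘ₗ
    (LinearEquiv.ofBijective _ A.mul_bijective).symm.toLinearMap

open Classical in
theorem coeff_ofSym_mul_T (w u : D.extAffWeyl) (p : SymmetricAlgebra ℂ (HHat V)) :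
    A.coeff w (A.ofSym p * A.T u) = if u = w then p else 0 := by
  have h : A.ofSym p * A.T u =
      LinearEquiv.ofBijective _ A.mul_bijective (p ⊗ₜ MonoidAlgebra.of ℂ _ u) := by
    simp [T]
  rw [h, coeff]
  simp only [LinearMap.comp_apply, LinearEquiv.coe_coe, LinearEquiv.symm_apply_apply]
  simp [MonoidAlgebra.of_apply, Finsupp.single_apply]

theorem coeff_self (w : D.extAffWeyl) (p : SymmetricAlgebra ℂ (HHat V)) :
    A.coeff w (A.ofSym p * A.T w) = p := by
  rw [coeff_ofSym_mul_T, if_pos rfl]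

/-- The span of the `p w` with `p ∈ S(ĥ)` and `w` of length less than `n`. -/
def lower (n : ℕ) : Submodule ℂ H :=
  Submodule.span ℂ {h | ∃ p u, D.len u < n ∧ h = A.ofSym p * A.T u}

theorem ofSym_mul_mem_lower {n : ℕ} {h : H} (hh : h ∈ A.lower n)
    (p : SymmetricAlgebra ℂ (HHat V)) : A.ofSym p * h ∈ A.lower n := by
  induction hh using Submodule.span_induction with
  | mem x hx =>
    obtain ⟨q, u, hu, rfl⟩ := hx
    exact Submodule.subset_span ⟨p * q, u, hu, by rw [map_mul, mul_assoc]⟩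
  | zero => rw [mul_zero]; exact zero_mem _
  | add x y _ _ hx hy => rw [mul_add]; exact add_mem hx hy
  | smul r x _ hx => rw [mul_smul_comm]; exact Submodule.smul_mem _ _ hx

theorem mul_T_s_mem_lower [Finite ι] {n : ℕ} {h : H} (hh : h ∈ A.lower n) {a : D.affRoots}
    (ha : (a : HHat V) ∈ D.simpleAffRoots) : h * A.T (D.s a) ∈ A.lower (n + 1) := by
  induction hh using Submodule.span_induction with
  | mem x hx =>
    obtain ⟨q, u, hu, rfl⟩ := hx
    refine Submodule.subset_span ⟨q, u * D.s a, ?_, by rw [T_mul, mul_assoc]⟩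
    have := D.len_mul_s_le u ha
    omega
  | zero => rw [zero_mul]; exact zero_mem _
  | add x y _ _ hx hy => rw [add_mul]; exact add_mem hx hy
  | smul r x _ hx => rw [smul_mul_assoc]; exact Submodule.smul_mem _ _ hx

theorem coeff_eq_zero_of_mem_lower {n : ℕ} {h : H} (hh : h ∈ A.lower n) {w : D.extAffWeyl}
    (hw : n ≤ D.len w) : A.coeff w h = 0 := by
  induction hh using Submodule.span_induction with
  | mem x hx =>
    obtain ⟨q, u, hu, rfl⟩ := hx
    rw [coeff_ofSym_mul_T, if_neg]
    rintro rfl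
    omega
  | zero => rw [map_zero]
  | add x y _ _ hx hy => rw [map_add, hx, hy, add_zero]
  | smul r x _ hx => rw [map_smul, hx, smul_zero]

/-- `w v = w(v) w` up to terms of smaller length. -/
theorem T_mul_ofSym_ι_sub_mem_lower [Finite ι] {n : ℕ} {w : D.extAffWeyl} (hw : D.IsWord n w)
    (v : HHat V) :
    A.T w * A.ofSym (SymmetricAlgebra.ι ℂ _ v) -
      A.ofSym (SymmetricAlgebra.ι ℂ _ ((w : HHat V ≃ₗ[ℂ] HHat V) v)) * A.T w ∈ A.lower n := by
  induction hw generalizing v with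
  | omega w hw =>
    have := A.cross_omega w hw v
    rw [T, this, sub_self]
    exact zero_mem _
  | mul_s n w a ha hw ih =>
    have h1 : A.T (D.s a) * A.ofSym (SymmetricAlgebra.ι ℂ _ v) = _ := A.cross_refl a ha v
    have h2 := A.mul_T_s_mem_lower (ih (D.affRefl a v)) ha
    -- The scalar term -k_a (a, v) of the cross relation leaves a multiple of w itself, of length at
    -- most n.
    have h3 : A.T w ∈ A.lower (n + 1) := by
      refine Submodule.subset_span ⟨1, w, ?_, by rw [map_one, one_mul]⟩
      have := D.len_le hw
      omega
    have h4 : (((w * D.s a : D.extAffWeyl) : HHat V ≃ₗ[ℂ] HHat V)) v =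
        (w : HHat V ≃ₗ[ℂ] HHat V) (D.affRefl a v) := rfl
    rw [h4, T_mul, mul_assoc, h1]
    convert sub_mem h2 (Submodule.smul_mem _ (k a * formHat V a v) h3) using 1
    rw [mul_sub, ← Algebra.commutes, ← Algebra.smul_def, sub_mul]
    simp only [T, mul_assoc]
    abel

/-- The top coefficients of a commutator `[z, v]`. -/
theorem coeff_commutator [Finite ι] (f : D.extAffWeyl →₀ SymmetricAlgebra ℂ (HHat V))
    {w : D.extAffWeyl} (hw : ∀ u ∈ f.support, D.len u ≤ D.len w) (v : HHat V) :
    A.coeff w (A.ofFinsupp f * A.ofSym (SymmetricAlgebra.ι ℂ _ v) -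
      A.ofSym (SymmetricAlgebra.ι ℂ _ v) * A.ofFinsupp f) =
      f w * (SymmetricAlgebra.ι ℂ _ ((w : HHat V ≃ₗ[ℂ] HHat V) v) -
        SymmetricAlgebra.ι ℂ _ v) := by
  classical
  rw [ofFinsupp_apply, Finset.sum_mul, Finset.mul_sum, ← Finset.sum_sub_distrib, map_sum]
  rw [Finset.sum_eq_single w]
  · rw [← A.coeff_self w (f w * _)]
    rw [← sub_eq_zero, ← map_sub]
    refine A.coeff_eq_zero_of_mem_lower (n := D.len w) ?_ le_rfl
    convert A.ofSym_mul_mem_lower (A.T_mul_ofSym_ι_sub_mem_lower (D.isWord_len w) v) (f w)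
      using 1
    rw [← mul_assoc, ← map_mul, mul_comm _ (f w)]
    simp only [map_mul, map_sub, mul_sub, sub_mul, mul_assoc]
    abel
  · intro u hu huw
    -- Even if u has the same length as w, the corrections coming from u are strictly shorter than
    -- w, while its leading term sits at u ≠ w.
    have h := A.coeff_eq_zero_of_mem_lower (A.ofSym_mul_mem_lower
      (A.T_mul_ofSym_ι_sub_mem_lower (D.isWord_len u) v) (f u)) (hw u hu)
    have h1 := A.coeff_ofSym_mul_T w u
      (f u * SymmetricAlgebra.ι ℂ _ ((u : HHat V ≃ₗ[ℂ] HHat V) v))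
    have h2 := A.coeff_ofSym_mul_T w u (SymmetricAlgebra.ι ℂ _ v * f u)
    rw [if_neg huw] at h1 h2
    rw [mul_sub, map_sub, sub_eq_zero, ← mul_assoc, ← mul_assoc, ← map_mul, h1] at h
    rw [map_sub, h, ← mul_assoc, ← map_mul, h2, sub_zero]
  · intro hfw
    simp [Finsupp.notMem_support_iff.mp hfw]

/-! ### The center -/

/-- Central elements of `Ĥ^Y(k)` belong to `S(ĥ)`. -/
theorem exists_eq_ofSym_of_mem_center [Finite ι] [FiniteDimensional ℝ V] {z : H}
    (hz : z ∈ Subalgebra.center ℂ H) : ∃ p, z = A.ofSym p := by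
  obtain ⟨f, rfl⟩ := A.ofFinsupp_surjective z
  have key (w : D.extAffWeyl) (hwf : w ∈ f.support)
      (hw : ∀ u ∈ f.support, D.len u ≤ D.len w) : w = 1 := by
    refine Subtype.ext (LinearEquiv.ext fun v => ?_)
    have h := A.coeff_commutator f hw v
    rw [Subalgebra.mem_center_iff.mp hz, sub_self, map_zero, eq_comm, mul_eq_zero] at h
    exact ι_injective (sub_eq_zero.mp (h.resolve_left (Finsupp.mem_support_iff.mp hwf)))
  -- A longest element of the support is 1, so all lengths in the support are 0. Elements of Ω also
  -- have length 0, but now every element of the support is longest, and the same argument makes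
  -- each of them 1.
  have hsupp : f.support ⊆ {1} := by
    intro w hw
    obtain ⟨w', hw', hmax⟩ := Finset.exists_max_image f.support D.len ⟨w, hw⟩
    have h1 := key w' hw' hmax
    subst h1
    rw [Finset.mem_singleton]
    refine key w hw fun u hu => (hmax u hu).trans ?_
    rw [D.len_one]
    exact Nat.zero_le _
  refine ⟨f 1, ?_⟩
  rw [Finsupp.support_subset_singleton.mp hsupp, ofFinsupp_single, T_one, mul_one,
    Finsupp.single_eq_same]

/-- `s_a p = s_a(p) s_a + Δ` with `a Δ = -(k_a (a, a) / 2) (p - s_a(p))`. -/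
theorem exists_T_s_mul_ofSym {a : D.affRoots} (ha : (a : HHat V) ∈ D.simpleAffRoots)
    (p : SymmetricAlgebra ℂ (HHat V)) : ∃ q,
    A.T (D.s a) * A.ofSym p = A.ofSym (symAct (D.affRefl a) p) * A.T (D.s a) + A.ofSym q ∧
      SymmetricAlgebra.ι ℂ _ (a : HHat V) * q =
        (-(k a * formHat V (a : HHat V) a / 2)) • (p - symAct (D.affRefl a) p) := by
  induction p using SymmetricAlgebra.induction with
  | algebraMap r =>
    refine ⟨0, ?_, by simp [AlgHom.commutes]⟩
    rw [AlgHom.commutes (symAct _), AlgHom.commutes A.ofSym, map_zero, add_zero, Algebra.commutes]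
  | ι v =>
    refine ⟨-algebraMap ℂ _ (k a * formHat V (a : HHat V) v), ?_, ?_⟩
    · rw [symAct_ι, map_neg, AlgHom.commutes, ← sub_eq_add_neg]
      exact A.cross_refl a ha v
    · have h0 := D.formHat_self_ne_zero a
      have hc : formHat V v (a : HHat V) = formHat V (a : HHat V) v := by
        rw [formHat_apply, formHat_apply, formH_comm]
        ring
      rw [symAct_ι, ← map_sub, ← map_smul, mul_neg, mul_comm, ← Algebra.smul_def, ← map_smul,
        ← map_neg]
      congr 1
      -- Here v - s_a(v) = (2 (v, a) / (a, a)) a, which accounts for the constant k_a (a, a) / 2.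
      rw [affRefl, refl_apply, sub_sub_cancel, smul_smul, ← neg_smul, map_smul, hc, smul_eq_mul]
      congr 1
      field_simp
  | mul p p' hp hp' =>
    obtain ⟨q, h1, h2⟩ := hp
    obtain ⟨q', h1', h2'⟩ := hp'
    -- Twisted Leibniz rule for divided differences: Δ(pp') = s_a(p) Δ(p') + Δ(p) p'.
    refine ⟨symAct (D.affRefl a) p * q' + q * p', ?_, ?_⟩
    · rw [map_mul, ← mul_assoc, h1, add_mul, mul_assoc, h1']
      simp only [map_mul, map_add, mul_add, mul_assoc, add_assoc]
    · have e : SymmetricAlgebra.ι ℂ _ (a : HHat V) * (symAct (D.affRefl a) p * q' + q * p') =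
          symAct (D.affRefl a) p * (SymmetricAlgebra.ι ℂ _ (a : HHat V) * q') +
            (SymmetricAlgebra.ι ℂ _ (a : HHat V) * q) * p' := by ring
      rw [e, h2, h2', mul_smul_comm, smul_mul_assoc, ← smul_add, map_mul]
      congr 1
      ring
  | add p p' hp hp' =>
    obtain ⟨q, h1, h2⟩ := hp
    obtain ⟨q', h1', h2'⟩ := hp'
    refine ⟨q + q', ?_, ?_⟩
    · simp only [map_add, mul_add, add_mul, h1, h1']
      abel
    · rw [mul_add, h2, h2', ← smul_add, map_add]
      congr 1
      abel

theorem T_mul_ofSym_of_mem_Omega {w : D.extAffWeyl} (hw : w ∈ D.Omega)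
    (p : SymmetricAlgebra ℂ (HHat V)) :
    A.T w * A.ofSym p = A.ofSym (symAct (w : HHat V ≃ₗ[ℂ] HHat V) p) * A.T w := by
  induction p using SymmetricAlgebra.induction with
  | algebraMap r =>
    rw [AlgHom.commutes, AlgHom.commutes, AlgHom.commutes, Algebra.commutes]
  | ι v =>
    rw [symAct_ι]
    exact A.cross_omega w hw v
  | mul p p' hp hp' =>
    rw [map_mul, ← mul_assoc, hp, mul_assoc, hp', map_mul, map_mul, mul_assoc]
  | add p p' hp hp' => rw [map_add, mul_add, hp, hp', map_add, map_add, add_mul]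

theorem mem_stab_of_mem_Omega {p : SymmetricAlgebra ℂ (HHat V)}
    (hp : A.ofSym p ∈ Subalgebra.center ℂ H) {w : D.extAffWeyl} (hw : w ∈ D.Omega) :
    (w : HHat V ≃ₗ[ℂ] HHat V) ∈ stab p := by
  have h := A.T_mul_ofSym_of_mem_Omega hw p
  rw [Subalgebra.mem_center_iff.mp hp] at h
  have h1 := congrArg (A.coeff w) h
  rw [coeff_self, coeff_self] at h1
  exact mem_stab.mpr h1.symm

/-- Comparing coefficients at s_a in p s_a = s_a(p) s_a + q gives p = s_a(p); the term q sits at 1,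
which differs from s_a because s_a(a) = -a ≠ a. -/
theorem affRefl_mem_stab {p : SymmetricAlgebra ℂ (HHat V)}
    (hp : A.ofSym p ∈ Subalgebra.center ℂ H) {a : D.affRoots}
    (ha : (a : HHat V) ∈ D.simpleAffRoots) : D.affRefl a ∈ stab p := by
  obtain ⟨q, h, -⟩ := A.exists_T_s_mul_ofSym ha p
  have h1 : (1 : D.extAffWeyl) ≠ D.s a := by
    intro h
    have h2 : (a : HHat V) = D.affRefl a a :=
      congrArg (fun w : D.extAffWeyl => (w : HHat V ≃ₗ[ℂ] HHat V) (a : HHat V)) h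
    rw [affRefl_self, eq_neg_iff_add_eq_zero, ← two_smul ℂ, smul_eq_zero] at h2
    exact D.ne_zero_of_mem_affRoots a.2 (h2.resolve_left two_ne_zero)
  rw [Subalgebra.mem_center_iff.mp hp, ← mul_one (A.ofSym q), ← A.T_one] at h
  have h2 := congrArg (A.coeff (D.s a)) h
  rw [map_add, coeff_self, coeff_self, coeff_ofSym_mul_T, if_neg h1, add_zero] at h2
  exact mem_stab.mpr h2.symm

theorem mem_stab_of_isWord {p : SymmetricAlgebra ℂ (HHat V)}
    (hp : A.ofSym p ∈ Subalgebra.center ℂ H) {n : ℕ} {w : D.extAffWeyl} (hw : D.IsWord n w) :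
    (w : HHat V ≃ₗ[ℂ] HHat V) ∈ stab p := by
  induction hw with
  | omega w hw => exact A.mem_stab_of_mem_Omega hp hw
  | mul_s n w a ha hw ih => exact (stab p).mul_mem ih (A.affRefl_mem_stab hp ha)

theorem mem_stab_of_mem_center [Finite ι] {p : SymmetricAlgebra ℂ (HHat V)}
    (hp : A.ofSym p ∈ Subalgebra.center ℂ H) (w : D.extAffWeyl) :
    (w : HHat V ≃ₗ[ℂ] HHat V) ∈ stab p := by
  obtain ⟨n, hn⟩ := D.exists_isWord w
  exact A.mem_stab_of_isWord hp hn

theorem mem_invariants_of_mem_center [Finite ι] {p : SymmetricAlgebra ℂ (HHat V)}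
    (hp : A.ofSym p ∈ Subalgebra.center ℂ H) : p ∈ D.invariants :=
  fun w hw => A.mem_stab_of_mem_center hp ⟨w, hw⟩

/-- For invariant p the correction q satisfies a q = 0 in a domain, so q = 0 and p commutes with
each simple s_a. It commutes with Ω by the cross relation, hence with all words, and with S(ĥ) by
commutativity. -/
theorem ofSym_mem_center [Finite ι] [FiniteDimensional ℝ V] {p : SymmetricAlgebra ℂ (HHat V)}
    (hp : p ∈ D.invariants) : A.ofSym p ∈ Subalgebra.center ℂ H := by
  have hT (w : D.extAffWeyl) : A.T w * A.ofSym p = A.ofSym p * A.T w := by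
    obtain ⟨n, hn⟩ := D.exists_isWord w
    induction hn with
    | omega w hw => rw [A.T_mul_ofSym_of_mem_Omega hw, hp _ w.2]
    | mul_s n w a ha hw ih =>
      obtain ⟨q, h1, h2⟩ := A.exists_T_s_mul_ofSym ha p
      rw [hp _ (D.affRefl_mem a), sub_self, smul_zero, mul_eq_zero] at h2
      have hq : q = 0 := h2.resolve_left fun h =>
        D.ne_zero_of_mem_affRoots a.2 (ι_injective (h.trans (map_zero _).symm))
      rw [hq, map_zero, add_zero, hp _ (D.affRefl_mem a)] at h1
      rw [T_mul, mul_assoc, h1, ← mul_assoc, ih, mul_assoc]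
  rw [Subalgebra.mem_center_iff]
  intro h
  obtain ⟨f, rfl⟩ := A.ofFinsupp_surjective h
  rw [ofFinsupp_apply, Finset.sum_mul, Finset.mul_sum]
  refine Finset.sum_congr rfl fun w _ => ?_
  rw [mul_assoc, hT, ← mul_assoc, ← mul_assoc, ← map_mul, ← map_mul, mul_comm]

/-- The center of `Ĥ^Y(k)` is `S(ĥ)^{Ŵ^Y}`. -/
theorem center_eq [Finite ι] [FiniteDimensional ℝ V] :
    Subalgebra.center ℂ H = D.invariants.map A.ofSym := by
  ext z
  rw [Subalgebra.mem_map]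
  constructor
  · intro hz
    obtain ⟨p, rfl⟩ := A.exists_eq_ofSym_of_mem_center hz
    exact ⟨p, A.mem_invariants_of_mem_center hz, rfl⟩
  · rintro ⟨p, hp, rfl⟩
    exact A.ofSym_mem_center hp

end ExtTrigCherednik

end AffineRootDatum

end Cherednik

open Cherednik in
theorem mainTheorem6 {ι V H : Type*} [Finite ι] [NormedAddCommGroup V] [InnerProductSpace ℝ V]
    [FiniteDimensional ℝ V] [Ring H] [Algebra ℂ H]
    (D : Cherednik.AffineRootDatum ι V) (hY : Submodule.span ℝ (D.Y : Set V) = ⊤)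
    (k : D.affRoots → ℂ) (hk : D.IsMultiplicity k) (A : D.ExtTrigCherednik k H)
    {m : ℕ} (v : OrthonormalBasis (Fin m) ℝ V) :
    Subalgebra.center ℂ H = D.invariants.map A.ofSym ∧
      D.invariants = Algebra.adjoin ℂ {symC V, casimir v} ∧
      AlgebraicIndependent ℂ ![symC V, casimir v] := by
  have := D.nontrivial
  exact ⟨A.center_eq, D.invariants_eq_adjoin hY v, algebraicIndependent_symC_casimir v⟩
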